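/- Let $t\in\{0,\dots,4\}$, $N>2$, and put $k_a=\mathrm i$ for $a\le t$, $k_a=1$ for $a>t$, and $\eta=\mathrm{diag}(-1,\dots,-1,1,\dots,1)$ with $t$ entries $-1$. With the Pauli matrices $\sigma_1,\sigma_2,\sigma_3$ and $\sigma_0=1$, consider the $4\times4$ matrices $$\gamma_1=k_1\sigma_1\otimes\sigma_0,\ \gamma_2=k_2\sigma_2\otimes\sigma_0,\ \gamma_3=k_3\sigma_3\otimes\sigma_1,\ \gamma_4=k_4\sigma_3\otimes\sigma_2,\quad \Gamma=\sigma_3\otimes\sigma_3,\quad C=\sigma_2\otimes\sigma_1,$$ or any equivalent spinor representation $R^{-1}\gamma_aR$, $R^{-1}\Gamma R$, $R^{\top}CR$ with $R\in GL_4(\mathbb C)$ (denoted again $\gamma_a,\Gamma,C$); let $\gamma^a=\eta^{ab}\gamma_b$. Let $\Omega$ be the algebra of complex polynomials in anticommuting variables $c^a$ ($a=1,\dots,4$, translation ghosts) and commuting variables $\xi_i^\alpha$ ($i=1,\dots,N$, $\alpha=1,\dots,4$, supersymmetry ghosts), and let $\mathrm{gh}$ be the coboundary operator $$\mathrm{gh}=-\tfrac12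 M^{ij}(\gamma^aC^{-1})_{\alpha\beta}\,\xi_i^\alpha\xi_j^\beta\,\frac{\partial}{\partial c^a},\qquad M^{ij}=-\mathrm i\,\delta^{ij}.$$ Write $\omega_1\sim\omega_2$ if $\omega_1-\omega_2=\mathrm{gh}\,\omega_3$ for some $\omega_3\in\Omega$. Regard spinors as row vectors, put $\xi_i^\pm=\tfrac12\xi_i(1\pm\Gamma)$, $\vartheta_i=c^a\xi_i\gamma_a$, $\vartheta_i^\pm=\tfrac12\vartheta_i(1\pm\Gamma)$, $u\cdot v=u^\alpha (C^{-1})_{\alpha\beta}v^\beta$ and $\Theta_{ij}=\vartheta_i^+\cdot\xi_j^+$. Below, $P,\tilde P_\alpha$ denote polynomials in the components of $\xi_1^-,\xi_2,\dots,\xi_N$; $Q,\tilde Q_\alpha$ polynomials in the components of $\xi_1^+,\xi_2,\dots,\xi_N$; and $\hat B$ a polynomial in the components of $\xi_2,\dots,\xi_N$. Then: (i) For $\omega\in\Omega$: $\mathrm{gh}\,\omega=0$ if and only if $\omega\sim P+Q$ for some $P(\xi_1^-,\xi_2,\dots,\xi_N)$, $Q(\xi_1^+,\xi_2,\dots,\xi_N)$.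 (ii) For all such $P,Q$: $P+Q\sim0$ if and only if there are $\hat B,\tilde P_\alpha,\tilde Q_\alpha$ with $$P+Q=\mathrm{gh}\Big[\Big(\Theta_{11}-\sum_{i=2}^N\Theta_{ii}\Big)\hat B+\vartheta_1^{+\alpha}\tilde P_\alpha+\vartheta_1^{-\alpha}\tilde Q_\alpha\Big].$$ Moreover, for all $\hat B,\tilde P_\alpha,\tilde Q_\alpha$ the right-hand side equals $$2\mathrm i\sum_{i,j=2}^N(\xi_i^+\cdot\xi_j^+)(\xi_i^-\cdot\xi_j^-)\hat B+2\mathrm i\sum_{i=2}^N\Big[(\xi_1^-\cdot\xi_i^-)\,\xi_i^{+\alpha}\tilde P_\alpha+(\xi_1^+\cdot\xi_i^+)\,\xi_i^{-\alpha}\tilde Q_\alpha\Big].$$ (iii) In particular, for every $p>0$, every $\omega\in\Omega$ that is homogeneous of degree $p$ in the $c^a$ and satisfies $\mathrm{gh}\,\omega=0$ satisfies $\omega\sim0$. -/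

import Mathlib

open scoped Kronecker

noncomputable section

namespace SusyCohomology

/-- The Pauli matrices. -/
def pauli1 : Matrix (Fin 2) (Fin 2) ℂ := !![0, 1; 1, 0]
def pauli2 : Matrix (Fin 2) (Fin 2) ℂ := !![0, -Complex.I; Complex.I, 0]
def pauli3 : Matrix (Fin 2) (Fin 2) ℂ := !![1, 0; 0, -1]

/-- The Kronecker product of two `2 × 2` matrices as a `4 × 4` matrix, in the usual (lexicographic)
order of the basis. -/
def kron (A B : Matrix (Fin 2) (Fin 2) ℂ) : Matrix (Fin 4) (Fin 4) ℂ :=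
  Matrix.reindex finProdFinEquiv finProdFinEquiv (A ⊗ₖ B)

/-- The numbers `k_a`: the imaginary unit for the first `t` directions, `1` for the others
(directions and spinor components are numbered from `0`). -/
def kFactor (t : ℕ) (a : Fin 4) : ℂ := if (a : ℕ) < t then Complex.I else 1

/-- The diagonal entries `η^{aa}` of the metric of signature `(t, 4 - t)`. -/
def metricSign (t : ℕ) (a : Fin 4) : ℂ := if (a : ℕ) < t then -1 else 1

/-- The data of a spinor representation in four dimensions: the gamma matrices `γ_a` with lower
index, the chirality matrix, and the charge conjugation matrix. -/
structure SpinorRep where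
  gamma : Fin 4 → Matrix (Fin 4) (Fin 4) ℂ
  chir : Matrix (Fin 4) (Fin 4) ℂ
  conj : Matrix (Fin 4) (Fin 4) ℂ

/-- The particular spinor representation for signature `(t, 4 - t)`. -/
def standardRep (t : ℕ) : SpinorRep where
  gamma := ![kFactor t 0 • kron pauli1 1, kFactor t 1 • kron pauli2 1,
    kFactor t 2 • kron pauli3 pauli1, kFactor t 3 • kron pauli3 pauli2]
  chir := kron pauli3 pauli3
  conj := kron pauli2 pauli1

/-- Equivalence of spinor representations: a change of basis of the spinor space. The first index of
`γ_a` and of the chirality matrix is a lower one and the second an upper one, the charge conjugation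
matrix is a bilinear form. -/
def SpinorRep.Equivalent (ρ ρ' : SpinorRep) : Prop :=
  ∃ R : Matrix (Fin 4) (Fin 4) ℂ, IsUnit R.det ∧
    (∀ a, ρ'.gamma a = R⁻¹ * ρ.gamma a * R) ∧
    ρ'.chir = R⁻¹ * ρ.chir * R ∧
    ρ'.conj = R.transpose * ρ.conj * R

/-- Polynomials in the (commuting) supersymmetry ghosts `ξ_i^α`, `i = 1, …, N`, `α = 1, …, 4`. -/
abbrev SusyPoly (N : ℕ) : Type := MvPolynomial (Fin N × Fin 4) ℂ

/-- The space `Ω` of polynomials in the (anticommuting) translation ghosts `c^a`, `a = 1, …, 4`, and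
the (commuting) supersymmetry ghosts: the exterior algebra on the `c^a` over the polynomials in the
supersymmetry ghosts. -/
abbrev GhostPoly (N : ℕ) : Type := ExteriorAlgebra (SusyPoly N) (Fin 4 → SusyPoly N)

/-- A polynomial in the supersymmetry ghosts as an element of `Ω`. -/
abbrev ofSusy {N : ℕ} (p : SusyPoly N) : GhostPoly N := algebraMap (SusyPoly N) (GhostPoly N) p

/-- A complex number as a constant polynomial in the supersymmetry ghosts. -/
abbrev const {N : ℕ} (z : ℂ) : SusyPoly N := MvPolynomial.C z

/-- The translation ghost `c^a`. -/
def transGhost {N : ℕ} (a : Fin 4) : GhostPoly N :=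
  ExteriorAlgebra.ι (SusyPoly N) (Pi.single a 1)

/-- The (left) derivative `∂/∂c^a`. -/
def transDeriv {N : ℕ} (a : Fin 4) : GhostPoly N →ₗ[SusyPoly N] GhostPoly N :=
  CliffordAlgebra.contractLeft (LinearMap.proj a)

/-- The part of `Ω` of `c`-degree `p`. -/
def cDegreePart (N p : ℕ) : Submodule (SusyPoly N) (GhostPoly N) :=
  ⋀[SusyPoly N]^p (Fin 4 → SusyPoly N)

/-- The supersymmetry ghost `ξ_i^α`. -/
def xi {N : ℕ} (i : Fin N) (α : Fin 4) : SusyPoly N := MvPolynomial.X (i, α)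

/-- The matrix `M = -i · 1` in the anticommutators of the supersymmetry generators. -/
def susyMatrix (N : ℕ) : Matrix (Fin N) (Fin N) ℂ := (-Complex.I) • 1

section

variable (t : ℕ) (ρ : SpinorRep) {N : ℕ}

/-- The coboundary operator
`gh = -½ M^{ij} (γ^a C⁻¹)_{αβ} ξ_i^α ξ_j^β ∂/∂c^a`, where `γ^a = η^{ab} γ_b`. -/
def gh : GhostPoly N →ₗ[SusyPoly N] GhostPoly N :=
  ∑ a : Fin 4, (∑ i : Fin N, ∑ j : Fin N, ∑ α : Fin 4, ∑ β : Fin 4,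
    const (-(1 / 2) * susyMatrix N i j *
      ((metricSign t a • ρ.gamma a) * ρ.conj⁻¹) α β) * xi i α * xi j β) • transDeriv a

/-- `ω₁ ∼ ω₂`: the difference is a coboundary. -/
def Cohomologous (ω₁ ω₂ : GhostPoly N) : Prop :=
  ∃ ω₃ : GhostPoly N, ω₁ - ω₂ = gh t ρ ω₃

/-- The components of `ξ_i^+ = ½ ξ_i (1 + Γ)`. -/
def xiPlus (i : Fin N) (α : Fin 4) : SusyPoly N :=
  ∑ β : Fin 4, const (((1 / 2 : ℂ) • (1 + ρ.chir)) β α) * xi i β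

/-- The components of `ξ_i^- = ½ ξ_i (1 - Γ)`. -/
def xiMinus (i : Fin N) (α : Fin 4) : SusyPoly N :=
  ∑ β : Fin 4, const (((1 / 2 : ℂ) • (1 - ρ.chir)) β α) * xi i β

/-- `ϑ_i^α = c^a ξ_i^β γ_{aβ}^α`. -/
def vtheta (i : Fin N) (α : Fin 4) : GhostPoly N :=
  ∑ a : Fin 4, (∑ β : Fin 4, const (ρ.gamma a β α) * xi i β) • transGhost a

/-- `ϑ_i^+ = ½ ϑ_i (1 + Γ)`. -/
def vthetaPlus (i : Fin N) (α : Fin 4) : GhostPoly N :=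
  ∑ β : Fin 4, const (N := N) (((1 / 2 : ℂ) • (1 + ρ.chir)) β α) • vtheta ρ i β

/-- `ϑ_i^- = ½ ϑ_i (1 - Γ)`. -/
def vthetaMinus (i : Fin N) (α : Fin 4) : GhostPoly N :=
  ∑ β : Fin 4, const (N := N) (((1 / 2 : ℂ) • (1 - ρ.chir)) β α) • vtheta ρ i β

/-- The product `u · v = u^α (C⁻¹)_{αβ} v^β` of spinors with components in the supersymmetry
ghosts. -/
def spinorDot (u v : Fin 4 → SusyPoly N) : SusyPoly N :=
  ∑ α : Fin 4, ∑ β : Fin 4, const (ρ.conj⁻¹ α β) * u α * v β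

/-- `Θ_{ij} = ϑ_i^+ · ξ_j^+ = ϑ_i^{+α} (C⁻¹)_{αβ} ξ_j^{+β}`. -/
def bigTheta (i j : Fin N) : GhostPoly N :=
  ∑ α : Fin 4, ∑ β : Fin 4, (const (ρ.conj⁻¹ α β) * xiPlus ρ j β) • vthetaPlus ρ i α

variable (N) [NeZero N]

/-- The polynomials in the components of `ξ_2, …, ξ_N`. -/
def polyRest : Subalgebra ℂ (SusyPoly N) :=
  Algebra.adjoin ℂ {x | ∃ i : Fin N, i ≠ 0 ∧ ∃ α, x = xi i α}

/-- The polynomials in the components of `ξ_1^-, ξ_2, …, ξ_N`. -/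
def polyMinus : Subalgebra ℂ (SusyPoly N) :=
  Algebra.adjoin ℂ ({x | ∃ α, x = xiMinus ρ 0 α} ∪ {x | ∃ i : Fin N, i ≠ 0 ∧ ∃ α, x = xi i α})

/-- The polynomials in the components of `ξ_1^+, ξ_2, …, ξ_N`. -/
def polyPlus : Subalgebra ℂ (SusyPoly N) :=
  Algebra.adjoin ℂ ({x | ∃ α, x = xiPlus ρ 0 α} ∪ {x | ∃ i : Fin N, i ≠ 0 ∧ ∃ α, x = xi i α})

variable {N}

/-- `(Θ_11 - ∑_{i ≥ 2} Θ_ii) B + ϑ_1^{+α} P_α + ϑ_1^{-α} Q_α`. -/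
def primitiveOf (B : SusyPoly N) (P Q : Fin 4 → SusyPoly N) : GhostPoly N :=
  B • (bigTheta ρ 0 0 - ∑ i ∈ Finset.univ.erase (0 : Fin N), bigTheta ρ i i)
    + ∑ α : Fin 4, P α • vthetaPlus ρ 0 α + ∑ α : Fin 4, Q α • vthetaMinus ρ 0 α

/-- `2i ∑_{i,j ≥ 2} (ξ_i^+ · ξ_j^+)(ξ_i^- · ξ_j^-) B
  + 2i ∑_{i ≥ 2} [(ξ_1^- · ξ_i^-) ξ_i^{+α} P_α + (ξ_1^+ · ξ_i^+) ξ_i^{-α} Q_α]`. -/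
def explicitCoboundary (B : SusyPoly N) (P Q : Fin 4 → SusyPoly N) : SusyPoly N :=
  const (2 * Complex.I) *
      (∑ i ∈ Finset.univ.erase (0 : Fin N), ∑ j ∈ Finset.univ.erase (0 : Fin N),
        spinorDot ρ (xiPlus ρ i) (xiPlus ρ j) * spinorDot ρ (xiMinus ρ i) (xiMinus ρ j)) * B
    + const (2 * Complex.I) * ∑ i ∈ Finset.univ.erase (0 : Fin N),
        (spinorDot ρ (xiMinus ρ 0) (xiMinus ρ i) * (∑ α : Fin 4, xiPlus ρ i α * P α)
          + spinorDot ρ (xiPlus ρ 0) (xiPlus ρ i) * (∑ α : Fin 4, xiMinus ρ i α * Q α))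

end

end SusyCohomology

end

open SusyCohomology

/-!
The coboundary operator `gh` is contraction of the exterior algebra on the translation ghosts with
a functional, that is, the Koszul differential of the four quadratic forms `gh c^a` in the
supersymmetry ghosts. In coordinates adapted to the chirality matrix these span the same space as
the quadrics `∑_i ξ_i^{+α} ξ_i^{-β}` with `α, β ∈ {1, 2}`. The change of spinor basis that relates
an arbitrary representation to the standard one is a linear substitution of the supersymmetry ghosts
under which the coboundary operator and the product of spinors are covariant (`ChangesBy`,
`ghDual_quadricBasis`), so all computations are done in the standard representation.

*Positive degree.* For `N > 2` the four quadrics form a regular sequence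
(`weaklyRegular_quadricSeq`): for a suitable weight their initial forms are pairwise coprime
monomials, and regularity of the initial forms implies regularity (`WeaklyRegular.of_initial`).
Hence the Koszul complex is acyclic in positive degree, which is shown by induction on the number of
translation ghosts involved, using only the commutation relations of contractions and
multiplications (`exists_primitive_of_mem_lowerPart`). So every cocycle is cohomologous to a
polynomial in the supersymmetry ghosts, and what remains is to describe these polynomials modulo the
ideal generated by the quadrics.

*Degree zero.* Write `x_α = ξ_1^{+α}`, `u_β = ξ_1^{-β}`. The quadrics are the relations
`x_α u_β + r_{αβ}`, where the `r_{αβ}` do not involve `ξ_1`. Replacing each `x_α u_β` by `-r_{αβ}`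
brings every polynomial to the form `P + Q` without mixed terms (`exists_normal_form`). The elements
`P + Q` of the ideal are exactly the combinations of `det r` and of the minors of `(r | x)` and
`(r | u)` (`isMinorComb_of_isUnmixed`): in a combination of the relations without mixed terms, the
cofactors of top degree in `x`, `u` form a syzygy of the monomials `x_α u_β`. Such syzygies are
linear combinations of the obvious ones, each of which turns the corresponding relations into a
minor, up to relations with cofactors of lower degree.

*Explicit form.* The Fierz identities `ghVthetaPlus_eq` and `ghVthetaMinus_eq` express the
coboundaries of `ϑ_i^±`, and with the antisymmetry of the product of spinors they give the stated
formula (`gh_primitiveOf_eq`). In adapted coordinates that formula is precisely a combination of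
`det r` and of the minors (`explicitCoboundary_standardRep`).
-/

namespace SusyCohomology

/-! ### Contractions on the exterior algebra of a free module -/


section Koszul

open ExteriorAlgebra CliffordAlgebra

variable {R M : Type*} [CommRing R] [AddCommGroup M] [Module R M] {n : ℕ}
  (e : Module.Basis (Fin n) R M)

/-- Contraction with a linear functional on the exterior algebra. When the functional takes the
values `f (e j)` on a basis `e`, this is the differential of the Koszul complex of these values. -/
abbrev contr (d : Module.Dual R M) : ExteriorAlgebra R M →ₗ[R] ExteriorAlgebra R M :=
  CliffordAlgebra.contractLeft d

theorem contr_ι_mul (d : Module.Dual R M) (v : M) (ω : ExteriorAlgebra R M) :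
    contr d (ι R v * ω) = d v • ω - ι R v * contr d ω :=
  contractLeft_ι_mul d v ω

theorem contr_contr_comm (d d' : Module.Dual R M) (ω : ExteriorAlgebra R M) :
    contr d (contr d' ω) = -contr d' (contr d ω) :=
  contractLeft_comm _ _ ω

theorem contr_algebraMap (d : Module.Dual R M) (r : R) :
    contr d (algebraMap R (ExteriorAlgebra R M) r) = 0 :=
  contractLeft_algebraMap _ _ r

theorem contr_ι (d : Module.Dual R M) (v : M) :
    contr d (ι R v) = algebraMap R _ (d v) :=
  contractLeft_ι _ d v

theorem contr_sum_smul {κ : Type*} (s : Finset κ) (c : κ → R) (d : κ → Module.Dual R M)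
    (ω : ExteriorAlgebra R M) :
    contr (∑ j ∈ s, c j • d j) ω = ∑ j ∈ s, c j • contr (d j) ω := by
  simp [contr, map_sum, LinearMap.sum_apply]

/-- The projection `1 - e_i ∂_i` onto the elements that do not involve `e_i`. -/
noncomputable def killVar (i : Fin n) : ExteriorAlgebra R M →ₗ[R] ExteriorAlgebra R M :=
  LinearMap.id - LinearMap.mulLeft R (ι R (e i)) ∘ₗ contr (e.coord i)

theorem killVar_apply (i : Fin n) (ω : ExteriorAlgebra R M) :
    killVar e i ω = ω - ι R (e i) * contr (e.coord i) ω := rfl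

theorem killVar_ι_mul_self (i : Fin n) (ω : ExteriorAlgebra R M) :
    killVar e i (ι R (e i) * ω) = 0 := by
  rw [killVar_apply, contr_ι_mul, mul_sub, ← mul_assoc, ι_sq_zero]
  simp

theorem killVar_ι_mul_of_ne {i j : Fin n} (h : i ≠ j) (ω : ExteriorAlgebra R M) :
    killVar e i (ι R (e j) * ω) = ι R (e j) * killVar e i ω := by
  have hs : ι R (e i) * ι R (e j) = -(ι R (e j) * ι R (e i)) :=
    eq_neg_of_add_eq_zero_left (ι_add_mul_swap _ _)
  rw [killVar_apply, killVar_apply, contr_ι_mul, mul_sub, mul_sub, ← mul_assoc (ι R (e i)), hs]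
  simp [Finsupp.single_eq_of_ne h, mul_assoc]

/-- The composite of the projections `killVar` along a list of indices. -/
noncomputable def killVars (l : List (Fin n)) (ω : ExteriorAlgebra R M) : ExteriorAlgebra R M :=
  l.foldr (fun i => killVar e i) ω

theorem killVars_algebraMap (l : List (Fin n)) (r : R) :
    killVars e l (algebraMap R _ r) = algebraMap R _ r := by
  induction l with
  | nil => rfl
  | cons i l ih =>
    change killVar e i (killVars e l _) = _
    rw [ih, killVar_apply, contr_algebraMap]
    simp

theorem killVars_add (l : List (Fin n)) (ω ω' : ExteriorAlgebra R M) :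
    killVars e l (ω + ω') = killVars e l ω + killVars e l ω' := by
  induction l with
  | nil => rfl
  | cons i l ih =>
    change killVar e i (killVars e l _) = killVar e i (killVars e l _) + killVar e i (killVars e l _)
    rw [ih, map_add]

theorem killVars_smul (l : List (Fin n)) (r : R) (ω : ExteriorAlgebra R M) :
    killVars e l (r • ω) = r • killVars e l ω := by
  induction l with
  | nil => rfl
  | cons i l ih =>
    change killVar e i (killVars e l _) = r • killVar e i (killVars e l _)
    rw [ih, map_smul]

theorem killVars_ι_mul_cases (l : List (Fin n)) (j : Fin n) (ω : ExteriorAlgebra R M) :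
    killVars e l (ι R (e j) * ω) = 0 ∨
      (j ∉ l ∧ killVars e l (ι R (e j) * ω) = ι R (e j) * killVars e l ω) := by
  induction l with
  | nil => exact Or.inr ⟨by simp, rfl⟩
  | cons i l ih =>
    change killVar e i (killVars e l _) = 0 ∨ (_ ∧ killVar e i (killVars e l _) =
      ι R (e j) * killVar e i (killVars e l _))
    rcases ih with h | ⟨hj, h⟩
    · left; rw [h, map_zero]
    · rw [h]
      by_cases hij : i = j
      · subst hij; left; exact killVar_ι_mul_self e i _
      · right
        exact ⟨by simp [hj, Ne.symm hij], killVar_ι_mul_of_ne e hij _⟩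

theorem killVars_finRange_ι_mul (v : M) (ω : ExteriorAlgebra R M) :
    killVars e (List.finRange n) (ι R v * ω) = 0 := by
  have hbase (j : Fin n) : killVars e (List.finRange n) (ι R (e j) * ω) = 0 := by
    rcases killVars_ι_mul_cases e (List.finRange n) j ω with h | ⟨h, -⟩
    · exact h
    · exact absurd (List.mem_finRange j) h
  induction e.mem_span v using Submodule.span_induction with
  | mem x hx => obtain ⟨j, rfl⟩ := hx; exact hbase j
  | zero => simpa using killVars_algebraMap e (List.finRange n) 0
  | add x y _ _ hx hy => rw [map_add, add_mul, killVars_add, hx, hy, add_zero]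
  | smul c x _ hx => rw [map_smul, smul_mul_assoc, killVars_smul, hx, smul_zero]

/-- An element annihilated by all derivatives is a scalar: the product of the projections
`1 - e_i ∂_i` is the projection onto the scalars and fixes it. -/
theorem exists_algebraMap_of_contr_coord_eq_zero {ω : ExteriorAlgebra R M}
    (h : ∀ j, contr (e.coord j) ω = 0) : ∃ r : R, ω = algebraMap R _ r := by
  have hfix (l : List (Fin n)) : killVars e l ω = ω := by
    induction l with
    | nil => rfl
    | cons i l ih =>
      change killVar e i (killVars e l _) = _
      rw [ih, killVar_apply, h]
      simp
  have hscal (ω : ExteriorAlgebra R M) :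
      ∃ r : R, killVars e (List.finRange n) ω = algebraMap R _ r := by
    induction ω using CliffordAlgebra.left_induction with
    | algebraMap r => exact ⟨r, killVars_algebraMap e _ r⟩
    | add x y hx hy =>
      obtain ⟨r, hr⟩ := hx
      obtain ⟨s, hs⟩ := hy
      exact ⟨r + s, by rw [killVars_add, hr, hs, map_add]⟩
    | ι_mul x m _ => exact ⟨0, by rw [map_zero]; exact killVars_finRange_ι_mul e m x⟩
  obtain ⟨r, hr⟩ := hscal ω
  exact ⟨r, by rw [← hr, hfix]⟩

/-! ### Acyclicity of the Koszul complex of a regular sequence -/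

/-- The elements of the exterior algebra that involve only the basis vectors `e_j` with `j < k`. -/
noncomputable def lowerPart (k : ℕ) : Submodule R (ExteriorAlgebra R M) :=
  ⨅ j : {j : Fin n // k ≤ j}, LinearMap.ker (contr (e.coord j.1))

theorem mem_lowerPart {k : ℕ} {ω : ExteriorAlgebra R M} :
    ω ∈ lowerPart e k ↔ ∀ j : Fin n, k ≤ j → contr (e.coord j) ω = 0 := by
  simp [lowerPart, Submodule.mem_iInf]

theorem ι_mul_mem_lowerPart {k : ℕ} {i : Fin n} (hi : (i : ℕ) < k) {ω : ExteriorAlgebra R M}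
    (h : ω ∈ lowerPart e k) : ι R (e i) * ω ∈ lowerPart e k := by
  rw [mem_lowerPart] at h ⊢
  intro j hj
  have hij : i ≠ j := fun hij => by subst hij; omega
  rw [contr_ι_mul, h j hj]
  simp [Finsupp.single_eq_of_ne hij.symm]

theorem algebraMap_mem_lowerPart (k : ℕ) (r : R) :
    algebraMap R (ExteriorAlgebra R M) r ∈ lowerPart e k := by
  rw [mem_lowerPart]
  intro j _
  exact contr_algebraMap _ r

variable (f : Module.Dual R M)

/-- The ideal generated by the first `k` members of a finite sequence. -/
def initialIdeal (p : Fin n → R) (k : ℕ) : Ideal R :=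
  Ideal.span (p '' {j | (j : ℕ) < k})

/-- Each member of the sequence is a nonzerodivisor modulo the ideal generated by the preceding
ones. -/
def WeaklyRegular (p : Fin n → R) : Prop :=
  ∀ (k : Fin n) (r : R), r * p k ∈ initialIdeal p k → r ∈ initialIdeal p k

theorem algebraMapInv_contr_mem {k : ℕ} {ω : ExteriorAlgebra R M} (h : ω ∈ lowerPart e k) :
    algebraMapInv (contr f ω) ∈ initialIdeal (fun j => f (e j)) k := by
  have hf : f = ∑ j, f (e j) • e.coord j := by
    refine e.ext fun i => ?_
    simp
  rw [hf, contr_sum_smul, map_sum, ← hf]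
  refine Ideal.sum_mem _ fun j _ => ?_
  rw [map_smul, smul_eq_mul]
  by_cases hj : (j : ℕ) < k
  · exact Ideal.mul_mem_right _ _ (Ideal.subset_span ⟨j, hj, rfl⟩)
  · rw [(mem_lowerPart e).1 h j (not_lt.1 hj), map_zero, mul_zero]
    exact Ideal.zero_mem _

theorem exists_contr_eq_algebraMap {k : ℕ} {r : R}
    (h : r ∈ initialIdeal (fun j => f (e j)) k) :
    ∃ η ∈ lowerPart e k, contr f η = algebraMap R _ r := by
  induction h using Submodule.span_induction with
  | mem x hx =>
    obtain ⟨j, hj, rfl⟩ := hx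
    refine ⟨ι R (e j), ?_, contr_ι f _⟩
    have := ι_mul_mem_lowerPart e hj (algebraMap_mem_lowerPart (M := M) e k 1)
    simpa using this
  | zero => exact ⟨0, Submodule.zero_mem _, by simp⟩
  | add x y _ _ hx hy =>
    obtain ⟨a, ha, ha'⟩ := hx
    obtain ⟨b, hb, hb'⟩ := hy
    exact ⟨a + b, Submodule.add_mem _ ha hb, by rw [map_add, map_add, ha', hb']⟩
  | smul c x _ hx =>
    obtain ⟨a, ha, ha'⟩ := hx
    exact ⟨c • a, Submodule.smul_mem _ c ha, by
      rw [map_smul, ha', smul_eq_mul, map_mul, Algebra.smul_def]⟩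

/-- Induction on the number of basis vectors involved: write `ω = a + e_k b` with `a`, `b` free of
`e_k`. Then `b` is a cocycle, hence by induction exact up to a scalar, which regularity shows to be
exact as well; the rest of `ω` is cohomologous to a cocycle free of `e_k`. -/
theorem exists_primitive_of_mem_lowerPart (hreg : WeaklyRegular fun j => f (e j)) (k : ℕ)
    (hk : k ≤ n) (ω : ExteriorAlgebra R M) (hω : ω ∈ lowerPart e k) (hf : contr f ω = 0) :
    ∃ η ∈ lowerPart e k, ∃ r : R, ω = contr f η + algebraMap R _ r := by
  induction k generalizing ω with
  | zero =>
    obtain ⟨r, hr⟩ := exists_algebraMap_of_contr_coord_eq_zero e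
      (fun j => (mem_lowerPart e).1 hω j (Nat.zero_le _))
    exact ⟨0, Submodule.zero_mem _, r, by rw [map_zero, zero_add, hr]⟩
  | succ k ih =>
    have hmono : lowerPart (R := R) e k ≤ lowerPart e (k + 1) := fun x hx =>
      (mem_lowerPart e).2 fun j hj => (mem_lowerPart e).1 hx j (by omega)
    set i : Fin n := ⟨k, hk⟩ with hi
    set b := contr (e.coord i) ω with hb
    set a := ω - ι R (e i) * b with ha
    have hbb : contr (e.coord i) b = 0 := CliffordAlgebra.contractLeft_contractLeft _ _
    have hgt (j : Fin n) (hj : k ≤ j) : j = i ∨ k + 1 ≤ (j : ℕ) := by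
      rcases Nat.eq_or_lt_of_le hj with h | h
      · left; ext; exact h.symm
      · right; exact h
    have hbV : b ∈ lowerPart e k := by
      rw [mem_lowerPart]
      intro j hj
      rcases hgt j hj with rfl | hj'
      · exact hbb
      · rw [hb, contr_contr_comm, (mem_lowerPart e).1 hω j hj', map_zero, neg_zero]
    have haV : a ∈ lowerPart e k := by
      rw [mem_lowerPart]
      intro j hj
      rw [ha, map_sub, contr_ι_mul, (mem_lowerPart e).1 hbV j hj]
      rcases hgt j hj with rfl | hj'
      · simp [hb]
      · have hne : i ≠ j := fun h => by rw [← h] at hj'; simp [hi] at hj'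
        rw [(mem_lowerPart e).1 hω j hj']
        simp [Finsupp.single_eq_of_ne hne.symm]
    have hfb : contr f b = 0 := by rw [hb, contr_contr_comm, hf, map_zero, neg_zero]
    have hfa : contr f a = -(f (e i) • b) := by
      rw [ha, map_sub, contr_ι_mul, hf, hfb, mul_zero, sub_zero, zero_sub]
    obtain ⟨η, hη, r, hr⟩ := ih (by omega) b hbV hfb
    have hrmem : r ∈ initialIdeal (fun j => f (e j)) k := by
      refine hreg i r ?_
      have h1 : contr f (-(a + f (e i) • η)) = algebraMap R _ (r * f (e i)) := by
        rw [map_neg, map_add, map_smul, hfa, hr, smul_add, mul_comm, map_mul, Algebra.smul_def,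
          Algebra.smul_def]
        abel
      have h2 := algebraMapInv_contr_mem e f
        (Submodule.neg_mem _ (Submodule.add_mem _ haV (Submodule.smul_mem _ (f (e i)) hη)))
      rwa [h1, algebraMap_leftInverse] at h2
    obtain ⟨η₁, hη₁, hη₁'⟩ := exists_contr_eq_algebraMap e f hrmem
    have hb' : b = contr f (η + η₁) := by rw [map_add, hη₁', ← hr]
    set ζ := η + η₁ with hζ
    have hζV : ζ ∈ lowerPart e k := Submodule.add_mem _ hη hη₁
    obtain ⟨η₂, hη₂, s, hs⟩ := ih (by omega) (a + f (e i) • ζ)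
      (Submodule.add_mem _ haV (Submodule.smul_mem _ _ hζV))
      (by rw [map_add, map_smul, hfa, ← hb']; abel)
    refine ⟨η₂ - ι R (e i) * ζ, Submodule.sub_mem _ (hmono hη₂)
      (ι_mul_mem_lowerPart e (by simp [hi]) (hmono hζV)), s, ?_⟩
    rw [map_sub, contr_ι_mul, ← hb']
    have h3 : ω = (a + f (e i) • ζ) - f (e i) • ζ + ι R (e i) * b := by rw [ha]; abel
    rw [h3, hs]
    abel

/-- For a regular sequence, every Koszul cocycle is a scalar up to a coboundary. -/
theorem exists_contr_add_algebraMap (hreg : WeaklyRegular fun j => f (e j))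
    (ω : ExteriorAlgebra R M) (hf : contr f ω = 0) :
    ∃ (η : ExteriorAlgebra R M) (r : R), ω = contr f η + algebraMap R _ r := by
  obtain ⟨η, -, r, h⟩ := exists_primitive_of_mem_lowerPart e f hreg n le_rfl ω
    ((mem_lowerPart e).2 fun j hj => absurd j.2 (by omega)) hf
  exact ⟨η, r, h⟩

/-- The scalars among the Koszul coboundaries form the ideal generated by the sequence. -/
theorem exists_contr_eq_algebraMap_iff (r : R) :
    (∃ η : ExteriorAlgebra R M, contr f η = algebraMap R _ r) ↔
      r ∈ Ideal.span (Set.range fun j => f (e j)) := by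
  have hI : Ideal.span (Set.range fun j => f (e j)) = initialIdeal (fun j => f (e j)) n := by
    rw [initialIdeal, ← Set.image_univ]
    congr 2
    ext j
    simp
  rw [hI]
  constructor
  · rintro ⟨η, hη⟩
    have := algebraMapInv_contr_mem e f (k := n) (ω := η)
      ((mem_lowerPart e).2 fun j hj => absurd j.2 (by omega))
    rwa [hη, algebraMap_leftInverse] at this
  · intro h
    obtain ⟨η, -, hη⟩ := exists_contr_eq_algebraMap e f h
    exact ⟨η, hη⟩

theorem algebraMapInv_eq_zero_of_mem_exteriorPower {p : ℕ} (hp : 0 < p) {ω : ExteriorAlgebra R M}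
    (h : ω ∈ ⋀[R]^p M) : algebraMapInv ω = 0 := by
  obtain ⟨q, rfl⟩ := Nat.exists_eq_succ_of_ne_zero hp.ne'
  change ω ∈ LinearMap.range (ι R : M →ₗ[R] _) ^ (q + 1) at h
  rw [pow_succ] at h
  refine Submodule.mul_induction_on h (fun m _ v hv => ?_) fun x y hx hy => ?_
  · obtain ⟨x, rfl⟩ := hv
    rw [map_mul]
    simp [algebraMapInv]
  · rw [map_add, hx, hy, add_zero]

/-- For a regular sequence, Koszul cocycles of positive degree are coboundaries. -/
theorem exists_contr_eq_of_mem_exteriorPower (hreg : WeaklyRegular fun j => f (e j)) {p : ℕ}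
    (hp : 0 < p) {ω : ExteriorAlgebra R M} (h : ω ∈ ⋀[R]^p M) (hf : contr f ω = 0) :
    ∃ η : ExteriorAlgebra R M, ω = contr f η := by
  obtain ⟨η, r, hr⟩ := exists_contr_add_algebraMap e f hreg ω hf
  have h0 := algebraMapInv_eq_zero_of_mem_exteriorPower hp h
  have h1 : algebraMapInv (contr f η) ∈ initialIdeal (fun j => f (e j)) n :=
    algebraMapInv_contr_mem e f ((mem_lowerPart e).2 fun j hj => absurd j.2 (by omega))
  rw [hr, map_add, algebraMap_leftInverse] at h0
  obtain ⟨ζ, -, hζ⟩ := exists_contr_eq_algebraMap e f h1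
  refine ⟨η - ζ, ?_⟩
  rw [map_sub, hζ, hr, eq_neg_of_add_eq_zero_left h0, map_neg, sub_neg_eq_add]

end Koszul

/-! ### Weights on polynomial rings -/


section Weights

open MvPolynomial

variable {σ K : Type*} [CommRing K] (w : σ → ℕ)

/-- The homomorphism `X_i ↦ X_i T^{w_i}`. It encodes the grading by the weight `w`: the coefficient
of `T^n` in the image of `f` is the component of weight `n` of `f`. -/
noncomputable def weightHom : MvPolynomial σ K →ₐ[K] Polynomial (MvPolynomial σ K) :=
  aeval fun i => Polynomial.C (X i) * Polynomial.X ^ w i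

/-- The component of weight `n` of a polynomial. -/
noncomputable def weightComp (n : ℕ) : MvPolynomial σ K →+ MvPolynomial σ K :=
  (Polynomial.lcoeff (MvPolynomial σ K) n).toAddMonoidHom.comp
    (weightHom (K := K) w).toRingHom.toAddMonoidHom

/-- All monomials of the polynomial have weight less than `n`. -/
def WeightLT (n : ℕ) (f : MvPolynomial σ K) : Prop :=
  ∀ m, n ≤ m → weightComp w m f = 0

/-- All monomials of the polynomial have weight `n`. -/
def IsWeightHomog (n : ℕ) (f : MvPolynomial σ K) : Prop :=
  weightHom w f = Polynomial.C f * Polynomial.X ^ n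

variable {w}

theorem weightComp_def (n : ℕ) (f : MvPolynomial σ K) :
    weightComp w n f = (weightHom w f).coeff n := rfl

theorem IsWeightHomog.weightComp_eq {n : ℕ} {f : MvPolynomial σ K} (h : IsWeightHomog w n f)
    (m : ℕ) : weightComp w m f = if m = n then f else 0 := by
  rw [weightComp_def, h, Polynomial.coeff_C_mul_X_pow]

theorem IsWeightHomog.mul {m n : ℕ} {f g : MvPolynomial σ K} (hf : IsWeightHomog w m f)
    (hg : IsWeightHomog w n g) : IsWeightHomog w (m + n) (f * g) := by
  unfold IsWeightHomog at *
  rw [map_mul, hf, hg, Polynomial.C_mul]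
  ring

theorem IsWeightHomog.add {n : ℕ} {f g : MvPolynomial σ K} (hf : IsWeightHomog w n f)
    (hg : IsWeightHomog w n g) : IsWeightHomog w n (f + g) := by
  unfold IsWeightHomog at *
  rw [map_add, hf, hg, Polynomial.C_add]
  ring

theorem isWeightHomog_zero (n : ℕ) : IsWeightHomog w n (0 : MvPolynomial σ K) := by
  simp [IsWeightHomog]

theorem isWeightHomog_X (i : σ) : IsWeightHomog w (w i) (X i : MvPolynomial σ K) := by
  simp [IsWeightHomog, weightHom]

theorem isWeightHomog_C (a : K) : IsWeightHomog w 0 (C a : MvPolynomial σ K) := by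
  simp only [IsWeightHomog, weightHom, pow_zero, mul_one]
  rw [aeval_C]
  rfl

theorem IsWeightHomog.weightComp_mul {μ : ℕ} {g : MvPolynomial σ K} (hg : IsWeightHomog w μ g)
    (n : ℕ) (f : MvPolynomial σ K) :
    weightComp w n (f * g) = if μ ≤ n then weightComp w (n - μ) f * g else 0 := by
  rw [weightComp_def, map_mul, hg, ← mul_assoc, Polynomial.coeff_mul_X_pow',
    Polynomial.coeff_mul_C, weightComp_def]

theorem isWeightHomog_weightComp (n : ℕ) (f : MvPolynomial σ K) :
    IsWeightHomog w n (weightComp w n f) := by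
  induction f using MvPolynomial.induction_on generalizing n with
  | C a =>
    rw [(isWeightHomog_C a).weightComp_eq]
    split_ifs with h
    · rw [h]; exact isWeightHomog_C a
    · exact isWeightHomog_zero n
  | add p q hp hq => rw [map_add]; exact (hp n).add (hq n)
  | mul_X p i hp =>
    rw [(isWeightHomog_X i).weightComp_mul]
    split_ifs with h
    · have := (hp (n - w i)).mul (isWeightHomog_X (w := w) i)
      rwa [Nat.sub_add_cancel h] at this
    · exact isWeightHomog_zero n

theorem weightLT_zero (n : ℕ) : WeightLT w n (0 : MvPolynomial σ K) := fun _ _ => map_zero _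

theorem WeightLT.add {n : ℕ} {f g : MvPolynomial σ K} (hf : WeightLT w n f)
    (hg : WeightLT w n g) : WeightLT w n (f + g) := fun m hm => by
  rw [map_add, hf m hm, hg m hm, add_zero]

theorem WeightLT.neg {n : ℕ} {f : MvPolynomial σ K} (hf : WeightLT w n f) :
    WeightLT w n (-f) := fun m hm => by rw [map_neg, hf m hm, neg_zero]

theorem WeightLT.sub {n : ℕ} {f g : MvPolynomial σ K} (hf : WeightLT w n f)
    (hg : WeightLT w n g) : WeightLT w n (f - g) := fun m hm => by
  rw [map_sub, hf m hm, hg m hm, sub_zero]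

theorem WeightLT.sum {κ : Type*} {s : Finset κ} {n : ℕ} {f : κ → MvPolynomial σ K}
    (hf : ∀ i ∈ s, WeightLT w n (f i)) : WeightLT w n (∑ i ∈ s, f i) := fun m hm => by
  rw [map_sum]
  exact Finset.sum_eq_zero fun i hi => hf i hi m hm

theorem WeightLT.mono {m n : ℕ} (h : m ≤ n) {f : MvPolynomial σ K} (hf : WeightLT w m f) :
    WeightLT w n f := fun k hk => hf k (h.trans hk)

theorem IsWeightHomog.weightLT {n m : ℕ} {f : MvPolynomial σ K} (hf : IsWeightHomog w n f)
    (h : n < m) : WeightLT w m f := fun k hk => by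
  rw [hf.weightComp_eq, if_neg (by omega)]

theorem exists_weightLT (f : MvPolynomial σ K) : ∃ n, WeightLT w n f :=
  ⟨(weightHom w f).natDegree + 1, fun _ hm => Polynomial.coeff_eq_zero_of_natDegree_lt hm⟩

theorem WeightLT.eq_zero {f : MvPolynomial σ K} (h : WeightLT w 0 f) : f = 0 := by
  have h1 : ((Polynomial.aeval (1 : MvPolynomial σ K)).restrictScalars K).comp (weightHom w)
      = AlgHom.id K (MvPolynomial σ K) := by
    ext i
    simp [weightHom]
  have h2 : weightHom w f = 0 := Polynomial.ext fun n => by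
    rw [← weightComp_def, h n (Nat.zero_le n), Polynomial.coeff_zero]
  have h3 := DFunLike.congr_fun h1 f
  simpa [h2] using h3.symm

theorem WeightLT.sub_weightComp {n : ℕ} {f : MvPolynomial σ K} (h : WeightLT w (n + 1) f) :
    WeightLT w n (f - weightComp w n f) := fun m hm => by
  rw [map_sub, (isWeightHomog_weightComp n f).weightComp_eq]
  split_ifs with h1
  · rw [h1, sub_self]
  · rw [h m (by omega), sub_zero]

theorem WeightLT.mul {a b : ℕ} {f g : MvPolynomial σ K} (hf : WeightLT w a f)
    (hg : WeightLT w (b + 1) g) : WeightLT w (a + b) (f * g) := fun m hm => by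
  rw [weightComp_def, map_mul, Polynomial.coeff_mul]
  refine Finset.sum_eq_zero fun x hx => ?_
  have hx := Finset.HasAntidiagonal.mem_antidiagonal.1 hx
  rcases le_or_gt a x.1 with h | h
  · rw [← weightComp_def, hf _ h, zero_mul]
  · rw [← weightComp_def _ g, hg x.2 (by omega), mul_zero]

theorem weightComp_mul_of_weightLT {a b : ℕ} {f g : MvPolynomial σ K}
    (hf : WeightLT w (a + 1) f) (hg : WeightLT w (b + 1) g) :
    weightComp w (a + b) (f * g) = weightComp w a f * weightComp w b g := by
  rw [weightComp_def, map_mul]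
  refine Polynomial.coeff_mul_add_eq_of_natDegree_le ?_ ?_
  · exact Polynomial.natDegree_le_iff_coeff_eq_zero.2 fun m hm => hf m hm
  · exact Polynomial.natDegree_le_iff_coeff_eq_zero.2 fun m hm => hg m hm

/-! ### Regularity from regularity of the initial forms -/

section Initial

variable {n : ℕ} {p m : Fin n → MvPolynomial σ K} {μ : Fin n → ℕ}

/-- A homogeneous element of the ideal of initial forms is the initial form of an element of the
ideal. -/
theorem exists_lift_initial (hp : ∀ j, WeightLT w (μ j + 1) (p j))
    (hm : ∀ j, weightComp w (μ j) (p j) = m j) {k : ℕ} {x : MvPolynomial σ K}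
    (hx : x ∈ initialIdeal m k) (c : MvPolynomial σ K) (a : ℕ) :
    ∃ h ∈ initialIdeal p k, WeightLT w (a + 1) h ∧ weightComp w a h = weightComp w a (c * x) := by
  induction hx using Submodule.span_induction generalizing c with
  | mem x hx =>
    obtain ⟨j, hj, rfl⟩ := hx
    have hmj : IsWeightHomog w (μ j) (m j) := hm j ▸ isWeightHomog_weightComp _ _
    by_cases ha : μ j ≤ a
    · have hc : WeightLT w (a - μ j + 1) (weightComp w (a - μ j) c) :=
        (isWeightHomog_weightComp _ _).weightLT (Nat.lt_succ_self _)
      refine ⟨weightComp w (a - μ j) c * p j,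
        Ideal.mul_mem_left _ _ (Ideal.subset_span ⟨j, hj, rfl⟩), ?_, ?_⟩
      · exact (hc.mul (hp j)).mono (by omega)
      · have h1 := weightComp_mul_of_weightLT hc (hp j)
        rw [Nat.sub_add_cancel ha, hm, (isWeightHomog_weightComp _ _).weightComp_eq,
          if_pos rfl] at h1
        rw [h1, hmj.weightComp_mul, if_pos ha]
    · refine ⟨0, Ideal.zero_mem _, weightLT_zero _, ?_⟩
      rw [hmj.weightComp_mul, if_neg ha, map_zero]
  | zero => exact ⟨0, Ideal.zero_mem _, weightLT_zero _, by simp⟩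
  | add x y _ _ hx hy =>
    obtain ⟨g, hg, hg1, hg2⟩ := hx c
    obtain ⟨h, hh, hh1, hh2⟩ := hy c
    exact ⟨g + h, Ideal.add_mem _ hg hh, hg1.add hh1, by
      rw [map_add, hg2, hh2, mul_add, map_add]⟩
  | smul b x _ hx =>
    obtain ⟨g, hg, hg1, hg2⟩ := hx (c * b)
    exact ⟨g, hg, hg1, by rw [hg2, smul_eq_mul, mul_assoc]⟩

/-- If the elements of weight at most `a` of the ideal have their top components in the ideal of
initial forms, then `p k` is a nonzerodivisor modulo the ideal: successively subtract elements of
the ideal that cancel the top component of the cofactor. -/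
theorem mem_initialIdeal_of_mul_mem (hp : ∀ j, WeightLT w (μ j + 1) (p j))
    (hm : ∀ j, weightComp w (μ j) (p j) = m j) (hreg : WeaklyRegular m) (k : Fin n)
    (hk : ∀ f ∈ initialIdeal p k, ∀ a, WeightLT w (a + 1) f →
      weightComp w a f ∈ initialIdeal m k)
    (r : MvPolynomial σ K) (h : r * p k ∈ initialIdeal p k) : r ∈ initialIdeal p k := by
  obtain ⟨a, ha⟩ := exists_weightLT (w := w) r
  induction a generalizing r with
  | zero => rw [ha.eq_zero]; exact Ideal.zero_mem _
  | succ a ih =>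
    have h1 := hk _ h (a + μ k) ((ha.mul (hp k)).mono (by omega))
    rw [weightComp_mul_of_weightLT ha (hp k), hm] at h1
    obtain ⟨g, hg, hg1, hg2⟩ := exists_lift_initial hp hm (hreg k _ h1) 1 a
    rw [one_mul, (isWeightHomog_weightComp _ _).weightComp_eq, if_pos rfl] at hg2
    have h2 : r - g ∈ initialIdeal p k := by
      refine ih (r - g) ?_ fun j hj => ?_
      · rw [sub_mul]; exact Ideal.sub_mem _ h (Ideal.mul_mem_right _ _ hg)
      · rcases Nat.eq_or_lt_of_le hj with rfl | hj'
        · rw [map_sub, hg2, sub_self]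
        · rw [map_sub, ha j hj', hg1 j hj', sub_zero]
    simpa using Ideal.add_mem _ h2 hg

theorem weightComp_mem_initialIdeal (hp : ∀ j, WeightLT w (μ j + 1) (p j))
    (hm : ∀ j, weightComp w (μ j) (p j) = m j) (hreg : WeaklyRegular m) (k : ℕ) (hk : k ≤ n) :
    ∀ f ∈ initialIdeal p k, ∀ a, WeightLT w (a + 1) f → weightComp w a f ∈ initialIdeal m k := by
  induction k with
  | zero =>
    intro f hf a _
    have : f = 0 := by simpa [initialIdeal] using hf
    rw [this, map_zero]
    exact Ideal.zero_mem _
  | succ k ih =>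
    specialize ih (by omega)
    set i : Fin n := ⟨k, hk⟩ with hi
    have hins (q : Fin n → MvPolynomial σ K) :
        q '' {j : Fin n | (j : ℕ) < k + 1} = insert (q i) (q '' {j : Fin n | (j : ℕ) < k}) := by
      rw [← Set.image_insert_eq]
      congr 1
      ext j
      simp only [Set.mem_ofPred_eq, Set.mem_insert_iff, Fin.ext_iff, hi]
      omega
    have hmono : initialIdeal m k ≤ initialIdeal m (k + 1) := by
      unfold initialIdeal
      rw [hins m]
      exact Ideal.span_mono (Set.subset_insert _ _)
    have hmi : m i ∈ initialIdeal m (k + 1) := Ideal.subset_span ⟨i, by simp [hi], rfl⟩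
    have hmh : IsWeightHomog w (μ i) (m i) := hm i ▸ isWeightHomog_weightComp _ _
    intro f hf a ha
    obtain ⟨s, g, hg, rfl⟩ : ∃ s, ∃ g ∈ initialIdeal p k, f = s * p i + g := by
      unfold initialIdeal at hf
      rw [hins p] at hf
      obtain ⟨s, g, hg, h⟩ := Ideal.mem_span_insert.1 hf
      exact ⟨s, g, hg, h⟩
    -- The cofactor `s` of `p i` may have a top component that cancels against `g`; it can be moved
    -- into `g` because `m i` is regular modulo the preceding initial forms.
    obtain ⟨b, hb⟩ := exists_weightLT (w := w) s
    induction b generalizing s g with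
    | zero =>
      rw [hb.eq_zero, zero_mul, zero_add] at ha ⊢
      exact hmono (ih g hg a ha)
    | succ b ihb =>
      have hsp : WeightLT w (b + μ i + 1) (s * p i) := (hb.mul (hp i)).mono (by omega)
      have hlead : weightComp w (b + μ i) (s * p i) = weightComp w b s * m i := by
        rw [weightComp_mul_of_weightLT hb (hp i), hm]
      by_cases hba : b + μ i ≤ a
      · have hga : WeightLT w (a + 1) g := by
          have := ha.sub (hsp.mono (by omega : b + μ i + 1 ≤ a + 1))
          simpa using this
        rw [map_add]
        refine Ideal.add_mem _ ?_ (hmono (ih g hg a hga))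
        rcases Nat.eq_or_lt_of_le hba with rfl | hlt
        · rw [hlead]; exact Ideal.mul_mem_left _ _ hmi
        · rw [hsp a hlt]; exact Ideal.zero_mem _
      · have hgb : WeightLT w (b + μ i + 1) g := by
          have := (ha.mono (by omega : a + 1 ≤ b + μ i + 1)).sub hsp
          simpa using this
        have h1 : weightComp w b s * m i ∈ initialIdeal m k := by
          have h2 := ha (b + μ i) (by omega)
          rw [map_add, hlead] at h2
          rw [eq_neg_of_add_eq_zero_left h2]
          exact Submodule.neg_mem _ (ih g hg _ hgb)
        obtain ⟨h, hh, hh1, hh2⟩ := exists_lift_initial hp hm (hreg i _ h1) 1 b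
        rw [one_mul, (isWeightHomog_weightComp _ _).weightComp_eq, if_pos rfl] at hh2
        have heq : s * p i + g = (s - h) * p i + (h * p i + g) := by ring
        rw [heq] at hf ha ⊢
        refine ihb (s - h) (h * p i + g) (Ideal.add_mem _ (Ideal.mul_mem_right _ _ hh) hg) hf ha
          fun j hj => ?_
        rcases Nat.eq_or_lt_of_le hj with rfl | hj'
        · rw [map_sub, hh2, sub_self]
        · rw [map_sub, hb j hj', hh1 j hj', sub_zero]

/-- A sequence whose initial forms with respect to some weight are a regular sequence is regular. -/
theorem WeaklyRegular.of_initial (hp : ∀ j, WeightLT w (μ j + 1) (p j))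
    (hm : ∀ j, weightComp w (μ j) (p j) = m j) (hreg : WeaklyRegular m) : WeaklyRegular p :=
  fun k r h => mem_initialIdeal_of_mul_mem hp hm hreg k
    (weightComp_mem_initialIdeal hp hm hreg k k.2.le) r h

end Initial

/-- Pairwise coprime monomials form a regular sequence. -/
theorem weaklyRegular_monomial {n : ℕ} (d : Fin n → σ →₀ ℕ)
    (hd : ∀ j k, j < k → ∀ i, d j i = 0 ∨ d k i = 0) :
    WeaklyRegular fun j => (monomial (d j) (1 : K) : MvPolynomial σ K) := by
  intro k r h
  have himg : (fun j => (monomial (d j) (1 : K) : MvPolynomial σ K)) '' {j | (j : ℕ) < k} =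
      (fun s => monomial s 1) '' (d '' {j | (j : ℕ) < k}) := by
    rw [Set.image_image]
  unfold initialIdeal at h ⊢
  rw [himg] at h ⊢
  rw [mem_ideal_span_monomial_image] at h ⊢
  intro x hx
  obtain ⟨_, ⟨j, hj, rfl⟩, hle⟩ := h (x + d k) (by
    rw [mem_support_iff] at hx ⊢
    simpa [coeff_mul_monomial] using hx)
  refine ⟨d j, ⟨j, hj, rfl⟩, fun i => ?_⟩
  have h1 := hle i
  rw [Finsupp.add_apply] at h1
  rcases hd j k hj i with h2 | h2 <;> omega

end Weights

/-! ### The four quadrics in adapted coordinates -/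

section Quadrics

open MvPolynomial

/-- The spinor indices of positive chirality in the standard representation. -/
def posIdx : Fin 2 → Fin 4 := ![0, 3]

/-- The spinor indices of negative chirality in the standard representation. -/
def negIdx : Fin 2 → Fin 4 := ![1, 2]

/-- The quadric `∑_i ξ_i^α ξ_i^β`, where `α` has positive and `β` negative chirality. -/
noncomputable def quadric (N : ℕ) (a b : Fin 2) : SusyPoly N :=
  ∑ i : Fin N, X (i, posIdx a) * X (i, negIdx b)

/-- The four quadrics as a sequence. -/
noncomputable def quadricSeq (N : ℕ) : Fin 4 → SusyPoly N :=
  ![quadric N 0 0, quadric N 0 1, quadric N 1 0, quadric N 1 1]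

/-- A weight for which the initial forms of the four quadrics are pairwise coprime. -/
def quadricWeight (N : ℕ) (x : Fin N × Fin 4) : ℕ :=
  match (x.1 : ℕ), x.2 with
  | 0, 0 => 4
  | 1, 0 => 3
  | 1, 2 => 2
  | 2, 2 => 4
  | 1, 3 => 1
  | _, _ => 0

theorem weightLT_sum_and_weightComp {N : ℕ} {w : Fin N × Fin 4 → ℕ} (i₀ : Fin N)
    (α β : Fin 4) (μ : ℕ) (h₀ : w (i₀, α) + w (i₀, β) = μ)
    (h : ∀ i, i ≠ i₀ → w (i, α) + w (i, β) < μ) :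
    WeightLT w (μ + 1) (∑ i, X (i, α) * X (i, β) : SusyPoly N) ∧
      weightComp w μ (∑ i, X (i, α) * X (i, β) : SusyPoly N) = X (i₀, α) * X (i₀, β) := by
  have hh (i : Fin N) : IsWeightHomog w (w (i, α) + w (i, β))
      (X (i, α) * X (i, β) : SusyPoly N) := (isWeightHomog_X _).mul (isWeightHomog_X _)
  constructor
  · refine WeightLT.sum fun i _ => (hh i).weightLT ?_
    by_cases hi : i = i₀
    · subst hi; omega
    · have := h i hi; omega
  · rw [map_sum, Finset.sum_eq_single i₀]
    · rw [(hh i₀).weightComp_eq, if_pos h₀.symm]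
    · intro i _ hi
      rw [(hh i).weightComp_eq, if_neg (h i hi).ne']
    · simp

/-- For three or more supersymmetries the four quadrics form a regular sequence. The initial forms
for the weight `quadricWeight` are `ξ_1^1 ξ_1^2`, `ξ_2^1 ξ_2^3`, `ξ_2^4 ξ_2^2`, `ξ_3^4 ξ_3^3`. -/
theorem weaklyRegular_quadricSeq {N : ℕ} (hN : 2 < N) : WeaklyRegular (quadricSeq N) := by
  set i0 : Fin N := ⟨0, by omega⟩ with h0
  set i1 : Fin N := ⟨1, by omega⟩ with h1
  set i2 : Fin N := ⟨2, by omega⟩ with h2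
  set row : Fin 4 → Fin N := ![i0, i1, i1, i2] with hrow
  set α : Fin 4 → Fin 4 := ![0, 0, 3, 3] with hα
  set β : Fin 4 → Fin 4 := ![1, 2, 1, 2] with hβ
  have hq (j : Fin 4) : quadricSeq N j = ∑ i, X (i, α j) * X (i, β j) := by
    fin_cases j <;> rfl
  have hkey (j : Fin 4) := weightLT_sum_and_weightComp (w := quadricWeight N) (row j) (α j) (β j)
    (![4, 5, 1, 4] j) (by fin_cases j <;> rfl) (by
      rintro ⟨i, hi⟩ hne
      fin_cases j <;> simp [hrow, h0, h1, h2] at hne <;>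
        rcases i with _ | _ | _ | i <;> simp_all [quadricWeight])
  simp_rw [← hq] at hkey
  refine WeaklyRegular.of_initial (fun j => (hkey j).1) (fun j => (hkey j).2) ?_
  have hmon : (fun j => X (row j, α j) * X (row j, β j) : Fin 4 → SusyPoly N) =
      fun j => monomial (Finsupp.single (row j, α j) 1 + Finsupp.single (row j, β j) 1) 1 := by
    funext j
    simp [X, monomial_mul]
  change WeaklyRegular (fun j => X (row j, α j) * X (row j, β j) : Fin 4 → SusyPoly N)
  rw [hmon]
  refine weaklyRegular_monomial _ fun j k hjk ⟨i, γ⟩ => ?_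
  simp only [Finsupp.add_apply, Finsupp.single_apply, Prod.mk.injEq]
  fin_cases j <;> fin_cases k <;> simp_all <;> grind

end Quadrics

/-! ### Two blocks of variables with prescribed products -/


section Blocks

open MvPolynomial

variable {σ K : Type*} [CommRing K]

open Classical in
/-- The endomorphism of the polynomial ring that sets the variables in a family to zero. -/
noncomputable def killBlock (x : Fin 2 → σ) : MvPolynomial σ K →ₐ[K] MvPolynomial σ K :=
  aeval fun i => if i ∈ Set.range x then 0 else X i

/-- The polynomials that do not involve the variables in a family. -/
noncomputable def freeOf (K : Type*) [CommRing K] (x : Fin 2 → σ) :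
    Subalgebra K (MvPolynomial σ K) :=
  AlgHom.equalizer (killBlock x) (AlgHom.id K _)

theorem mem_freeOf {x : Fin 2 → σ} {f : MvPolynomial σ K} :
    f ∈ freeOf K x ↔ killBlock x f = f := Iff.rfl

theorem killBlock_X_mem (x : Fin 2 → σ) (α : Fin 2) :
    killBlock x (X (x α) : MvPolynomial σ K) = 0 := by
  simp [killBlock]

theorem killBlock_X_of_notMem {x : Fin 2 → σ} {i : σ} (h : ∀ α, x α ≠ i) :
    killBlock x (X i : MvPolynomial σ K) = X i := by
  simp [killBlock, h]

theorem killBlock_comm (x u : Fin 2 → σ) (f : MvPolynomial σ K) :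
    killBlock x (killBlock u f) = killBlock u (killBlock x f) := by
  have : (killBlock x).comp (killBlock u) =
      (killBlock u).comp (killBlock (K := K) x) := by
    ext i
    by_cases h1 : i ∈ Set.range x <;> by_cases h2 : i ∈ Set.range u <;>
      simp_all [killBlock]
  exact DFunLike.congr_fun this f

theorem killBlock_mem (x : Fin 2 → σ) (f : MvPolynomial σ K) : killBlock x f ∈ freeOf K x := by
  have : (killBlock x).comp (killBlock x) = killBlock (K := K) x := by
    ext i
    by_cases h1 : i ∈ Set.range x <;> simp_all [killBlock]
  exact DFunLike.congr_fun this f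

theorem killBlock_mem_of_mem (x : Fin 2 → σ) {u : Fin 2 → σ} {f : MvPolynomial σ K}
    (h : f ∈ freeOf K u) : killBlock x f ∈ freeOf K u := by
  rw [mem_freeOf, killBlock_comm, mem_freeOf.1 h]

theorem weightComp_killBlock (w : σ → ℕ) (n : ℕ) (x : Fin 2 → σ) (f : MvPolynomial σ K) :
    weightComp w n (killBlock x f) = killBlock x (weightComp w n f) := by
  have : ((weightHom w).comp (killBlock x)) =
      (Polynomial.mapAlgHom (killBlock x)).comp (weightHom (K := K) w) := by
    ext1 i
    by_cases h1 : i ∈ Set.range x <;> simp_all [killBlock, weightHom]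
  rw [weightComp_def, ← AlgHom.comp_apply, this]
  simp [weightComp_def, Polynomial.coeff_map]

theorem WeightLT.killBlock {w : σ → ℕ} {n : ℕ} {f : MvPolynomial σ K} (h : WeightLT w n f)
    (x : Fin 2 → σ) : WeightLT w n (killBlock x f) := fun m hm => by
  rw [weightComp_killBlock, h m hm, map_zero]

theorem weightComp_mem_freeOf (w : σ → ℕ) (n : ℕ) {x : Fin 2 → σ} {f : MvPolynomial σ K}
    (h : f ∈ freeOf K x) : weightComp w n f ∈ freeOf K x := by
  rw [mem_freeOf, ← weightComp_killBlock, mem_freeOf.1 h]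

/-- The part of weight less than `n` of a polynomial. -/
noncomputable def weightTrunc (w : σ → ℕ) (n : ℕ) (f : MvPolynomial σ K) : MvPolynomial σ K :=
  ∑ m ∈ Finset.range n, weightComp w m f

theorem weightComp_weightTrunc (w : σ → ℕ) (n m : ℕ) (f : MvPolynomial σ K) :
    weightComp w m (weightTrunc w n f) = if m < n then weightComp w m f else 0 := by
  rw [weightTrunc, map_sum]
  simp_rw [(isWeightHomog_weightComp _ f).weightComp_eq]
  simp only [Finset.sum_ite_eq, Finset.mem_range]

theorem weightLT_weightTrunc (w : σ → ℕ) (n : ℕ) (f : MvPolynomial σ K) :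
    WeightLT w n (weightTrunc w n f) := fun m hm => by
  rw [weightComp_weightTrunc, if_neg (by omega)]

/-- The cofactors in a combination of homogeneous elements of weight `μ` can be truncated. -/
theorem WeightLT.eq_sum_weightTrunc {κ : Type*} [Fintype κ] {w : σ → ℕ} {n μ : ℕ}
    {f : MvPolynomial σ K} (hf : WeightLT w n f) {c m : κ → MvPolynomial σ K}
    (hm : ∀ j, IsWeightHomog w μ (m j)) (h : f = ∑ j, c j * m j) :
    f = ∑ j, weightTrunc w (n - μ) (c j) * m j := by
  rw [← sub_eq_zero]
  refine WeightLT.eq_zero (w := w) fun k _ => ?_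
  have h1 : weightComp w k f = ∑ j, if μ ≤ k then weightComp w (k - μ) (c j) * m j else 0 := by
    rw [h, map_sum]
    exact Finset.sum_congr rfl fun j _ => (hm j).weightComp_mul k (c j)
  rw [map_sub, map_sum]
  simp_rw [(hm _).weightComp_mul, weightComp_weightTrunc]
  by_cases hk : n ≤ k
  · rw [hf k hk, zero_sub, neg_eq_zero]
    refine Finset.sum_eq_zero fun j _ => ?_
    split_ifs
    · omega
    · rw [zero_mul]
    · rfl
  · rw [h1, sub_eq_zero]
    refine Finset.sum_congr rfl fun j _ => ?_
    split_ifs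
    · rfl
    · omega
    · rfl

theorem weightTrunc_mem_freeOf (w : σ → ℕ) (n : ℕ) {x : Fin 2 → σ} {f : MvPolynomial σ K}
    (h : f ∈ freeOf K x) : weightTrunc w n f ∈ freeOf K x :=
  Subalgebra.sum_mem _ fun m _ => weightComp_mem_freeOf w m h

theorem exists_sub_killBlock_eq (x : Fin 2 → σ) (f : MvPolynomial σ K) :
    ∃ a : Fin 2 → MvPolynomial σ K, f - killBlock x f = ∑ α, a α * X (x α) := by
  induction f using MvPolynomial.induction_on with
  | C a =>
    refine ⟨0, ?_⟩
    rw [← MvPolynomial.algebraMap_eq, AlgHom.commutes]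
    simp
  | add p q hp hq =>
    obtain ⟨a, ha⟩ := hp
    obtain ⟨b, hb⟩ := hq
    refine ⟨a + b, ?_⟩
    simp only [Pi.add_apply, add_mul, Finset.sum_add_distrib, ← ha, ← hb, map_add]
    ring
  | mul_X p i hp =>
    by_cases hi : ∃ α, x α = i
    · obtain ⟨α, rfl⟩ := hi
      refine ⟨Pi.single α p, ?_⟩
      rw [map_mul, killBlock_X_mem, mul_zero, sub_zero, Finset.sum_eq_single α]
      · simp
      · intro β _ hβ; simp [hβ]
      · simp
    · obtain ⟨a, ha⟩ := hp
      refine ⟨fun α => a α * X i, ?_⟩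
      rw [map_mul, killBlock_X_of_notMem (not_exists.1 hi), ← sub_mul, ha, Finset.sum_mul]
      exact Finset.sum_congr rfl fun α _ => by ring

/-- Two disjoint pairs of variables `x_α`, `u_β`, and polynomials `r_{αβ}` in the remaining
variables. -/
structure Blocks (x u : Fin 2 → σ) (r : Fin 2 → Fin 2 → MvPolynomial σ K) : Prop where
  injective_left : Function.Injective x
  injective_right : Function.Injective u
  disjoint : ∀ α β, x α ≠ u β
  mem_left : ∀ α β, r α β ∈ freeOf K x
  mem_right : ∀ α β, r α β ∈ freeOf K u

namespace Blocks

variable {x u : Fin 2 → σ} {r : Fin 2 → Fin 2 → MvPolynomial σ K}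

theorem symm (h : Blocks x u r) : Blocks u x (fun α β => r β α) :=
  ⟨h.injective_right, h.injective_left, fun α β => (h.disjoint β α).symm,
    fun α β => h.mem_right β α, fun α β => h.mem_left β α⟩

end Blocks

/-- The relation `x_α u_β + r_{αβ}`. -/
noncomputable def relator (x u : Fin 2 → σ) (r : Fin 2 → Fin 2 → MvPolynomial σ K)
    (α β : Fin 2) : MvPolynomial σ K :=
  X (x α) * X (u β) + r α β

/-- The minor `x_2 r_{1β} - x_1 r_{2β}`. -/
noncomputable def blockMinor (x : Fin 2 → σ) (r : Fin 2 → Fin 2 → MvPolynomial σ K)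
    (β : Fin 2) : MvPolynomial σ K :=
  X (x 1) * r 0 β - X (x 0) * r 1 β

/-- The determinant of the matrix `r`. -/
noncomputable def blockDet (r : Fin 2 → Fin 2 → MvPolynomial σ K) : MvPolynomial σ K :=
  r 0 0 * r 1 1 - r 0 1 * r 1 0

/-- The combinations of the determinant of `r`, with coefficients that involve neither block, and of
the minors of `(r | x)` and of `(r | u)`, with coefficients that do not involve the block absent
from the minor. These are the obvious polynomials without mixed terms in the ideal of the relations. -/
def IsMinorComb (x u : Fin 2 → σ) (r : Fin 2 → Fin 2 → MvPolynomial σ K)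
    (f : MvPolynomial σ K) : Prop :=
  ∃ B ∈ freeOf K x ⊓ freeOf K u, ∃ P Q : Fin 2 → MvPolynomial σ K,
    (∀ α, P α ∈ freeOf K x) ∧ (∀ β, Q β ∈ freeOf K u) ∧
    f = blockDet r * B + ∑ α, blockMinor u (fun α β => r β α) α * P α +
      ∑ β, blockMinor x r β * Q β

/-- The polynomials without terms that mix the two blocks. -/
def IsUnmixed (x u : Fin 2 → σ) (f : MvPolynomial σ K) : Prop :=
  ∃ P ∈ freeOf K x, ∃ Q ∈ freeOf K u, f = P + Q

variable {x u : Fin 2 → σ} {r : Fin 2 → Fin 2 → MvPolynomial σ K}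

theorem IsMinorComb.symm {f : MvPolynomial σ K} (h : IsMinorComb x u r f) :
    IsMinorComb u x (fun α β => r β α) f := by
  obtain ⟨B, hB, P, Q, hP, hQ, rfl⟩ := h
  refine ⟨B, ⟨hB.2, hB.1⟩, Q, P, hQ, hP, ?_⟩
  unfold blockDet
  ring

theorem IsMinorComb.add {f g : MvPolynomial σ K} (hf : IsMinorComb x u r f)
    (hg : IsMinorComb x u r g) : IsMinorComb x u r (f + g) := by
  obtain ⟨B, hB, P, Q, hP, hQ, rfl⟩ := hf
  obtain ⟨B', hB', P', Q', hP', hQ', rfl⟩ := hg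
  refine ⟨B + B', add_mem hB hB', P + P', Q + Q', fun α => add_mem (hP α) (hP' α),
    fun α => add_mem (hQ α) (hQ' α), ?_⟩
  simp only [Pi.add_apply, mul_add, Finset.sum_add_distrib]
  ring

theorem isMinorComb_zero : IsMinorComb x u r 0 :=
  ⟨0, zero_mem _, 0, 0, fun _ => zero_mem _, fun _ => zero_mem _, by simp⟩

theorem isMinorComb_minor_mul {f : MvPolynomial σ K} (hf : f ∈ freeOf K u) (β : Fin 2) :
    IsMinorComb x u r (blockMinor x r β * f) := by
  refine ⟨0, zero_mem _, 0, Pi.single β f, fun _ => zero_mem _, fun γ => ?_, ?_⟩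
  · rcases eq_or_ne γ β with rfl | h
    · simpa using hf
    · simp [h]
  · rw [Finset.sum_eq_single (s := Finset.univ) (a := β)
      (f := fun γ => blockMinor x r γ * (Pi.single β f : Fin 2 → _) γ)]
    · simp
    · intro γ _ h; simp [h]
    · simp

theorem exists_eq_add_sum_X_mul (h : Blocks x u r) {w : σ → ℕ} (hwu : ∀ β, w (u β) = 1) {n : ℕ}
    {f : MvPolynomial σ K} (hf : f ∈ freeOf K x) (hn : WeightLT w n f) :
    ∃ f₀ ∈ freeOf K x ⊓ freeOf K u, ∃ a : Fin 2 → MvPolynomial σ K,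
      (∀ β, a β ∈ freeOf K x) ∧ (∀ β, WeightLT w (n - 1) (a β)) ∧
      f = f₀ + ∑ β, a β * X (u β) := by
  obtain ⟨a, ha⟩ := exists_sub_killBlock_eq u f
  have h1 : f - killBlock u f = ∑ β, killBlock x (a β) * X (u β) := by
    have h2 := congrArg (killBlock x) ha
    rw [map_sub, killBlock_comm, mem_freeOf.1 hf, map_sum] at h2
    rw [h2]
    refine Finset.sum_congr rfl fun β _ => ?_
    rw [map_mul, killBlock_X_of_notMem fun α => h.disjoint α β]
  have h3 := (hn.sub (hn.killBlock u)).eq_sum_weightTrunc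
    (fun β => hwu β ▸ isWeightHomog_X (w := w) (u β)) h1
  exact ⟨killBlock u f, ⟨killBlock_mem_of_mem u hf, killBlock_mem u f⟩,
    fun β => weightTrunc w (n - 1) (killBlock x (a β)),
    fun β => weightTrunc_mem_freeOf w _ (killBlock_mem x _),
    fun β => weightLT_weightTrunc w _ _, by rw [← h3]; ring⟩

/-- By Cramer's rule the product of the determinant with any `u_β` is a combination of minors. -/
theorem isMinorComb_det_mul (h : Blocks x u r) {f : MvPolynomial σ K} (hf : f ∈ freeOf K x) :
    IsMinorComb x u r (blockDet r * f) := by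
  classical
  obtain ⟨n, hn⟩ := exists_weightLT (w := fun _ : σ => 1) f
  obtain ⟨f₀, hf₀, a, ha, -, rfl⟩ := exists_eq_add_sum_X_mul h (fun _ => rfl) hf hn
  refine ⟨f₀, hf₀, ![r 1 0 * a 0 + r 1 1 * a 1, -(r 0 0 * a 0 + r 0 1 * a 1)], 0, ?_,
    fun _ => zero_mem _, ?_⟩
  · intro α
    fin_cases α
    · exact add_mem (mul_mem (h.mem_left _ _) (ha _)) (mul_mem (h.mem_left _ _) (ha _))
    · exact neg_mem (add_mem (mul_mem (h.mem_left _ _) (ha _)) (mul_mem (h.mem_left _ _) (ha _)))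
  · simp [Fin.sum_univ_two, blockDet, blockMinor]
    ring

theorem exists_sub_eq_sum_X_mul_X (h : Blocks x u r) (f : MvPolynomial σ K) :
    ∃ c : Fin 2 × Fin 2 → MvPolynomial σ K,
      f - (killBlock x f + (killBlock u f - killBlock u (killBlock x f))) =
        ∑ j, c j * (X (x j.1) * X (u j.2)) := by
  obtain ⟨a, ha⟩ := exists_sub_killBlock_eq x f
  choose c hc using fun α => exists_sub_killBlock_eq u (a α)
  refine ⟨fun j => c j.1 j.2, ?_⟩
  have h1 := congrArg (killBlock u) ha
  rw [map_sub, map_sum] at h1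
  simp_rw [map_mul, killBlock_X_of_notMem fun β => (h.disjoint _ β).symm] at h1
  have h2 : f - (killBlock x f + (killBlock u f - killBlock u (killBlock x f))) =
      (f - killBlock x f) - (killBlock u f - killBlock u (killBlock x f)) := by ring
  rw [h2, ha, h1, ← Finset.sum_sub_distrib, Fintype.sum_prod_type]
  refine Finset.sum_congr rfl fun α _ => ?_
  rw [← sub_mul, hc, Finset.sum_mul]
  exact Finset.sum_congr rfl fun β _ => by ring

/-- Modulo the relations every polynomial is unmixed: replace each `x_α u_β` by `-r_{αβ}`. The
cofactors have lower weight than the polynomial when the two blocks have weight `1` and the `r_{αβ}`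
weight `0`. -/
theorem exists_normal_form (h : Blocks x u r) {w : σ → ℕ} (hwx : ∀ α, w (x α) = 1)
    (hwu : ∀ β, w (u β) = 1) (hr : ∀ α β, WeightLT w 1 (r α β)) (n : ℕ) (f : MvPolynomial σ K)
    (hf : WeightLT w n f) :
    ∃ P ∈ freeOf K x, ∃ Q ∈ freeOf K u, ∃ c : Fin 2 → Fin 2 → MvPolynomial σ K,
      WeightLT w n P ∧ WeightLT w n Q ∧ (∀ α β, WeightLT w (n - 1) (c α β)) ∧
      f = P + Q + ∑ α, ∑ β, c α β * relator x u r α β := by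
  induction n using Nat.strong_induction_on generalizing f with
  | _ n ih =>
    rcases Nat.eq_zero_or_pos n with rfl | hn
    · rw [hf.eq_zero]
      exact ⟨0, zero_mem _, 0, zero_mem _, 0, weightLT_zero _, weightLT_zero _,
        fun _ _ => weightLT_zero _, by simp⟩
    obtain ⟨c, hc⟩ := exists_sub_eq_sum_X_mul_X h f
    have hQ : WeightLT w n (killBlock u f - killBlock u (killBlock x f)) :=
      (hf.killBlock u).sub ((hf.killBlock x).killBlock u)
    have hc' := (hf.sub ((hf.killBlock x).add hQ)).eq_sum_weightTrunc (μ := 2) (fun j => by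
      have := (isWeightHomog_X (K := K) (w := w) (x j.1)).mul (isWeightHomog_X (w := w) (u j.2))
      rwa [hwx, hwu] at this) hc
    set d : Fin 2 → Fin 2 → MvPolynomial σ K := fun α β => weightTrunc w (n - 2) (c (α, β)) with hd
    have hdw (α β) : WeightLT w (n - 2) (d α β) := weightLT_weightTrunc _ _ _
    obtain ⟨P, hP, Q, hQ', e, hPw, hQw, hew, heq⟩ := ih (n - 2) (by omega)
      (-∑ α, ∑ β, d α β * r α β)
      (WeightLT.neg (WeightLT.sum fun α _ => WeightLT.sum fun β _ => (hdw α β).mul (hr α β)))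
    refine ⟨killBlock x f + P, add_mem (killBlock_mem x f) hP,
      killBlock u f - killBlock u (killBlock x f) + Q,
      add_mem (sub_mem (killBlock_mem u _) (killBlock_mem u _)) hQ', fun α β => d α β + e α β,
      (hf.killBlock x).add (hPw.mono (by omega)), hQ.add (hQw.mono (by omega)),
      fun α β => ((hdw α β).mono (by omega)).add ((hew α β).mono (by omega)), ?_⟩
    have h1 : f = (killBlock x f + (killBlock u f - killBlock u (killBlock x f))) +
        ∑ α, ∑ β, d α β * (X (x α) * X (u β)) := by
      rw [Fintype.sum_prod_type] at hc'
      rw [← hc']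
      ring
    have h2 : ∑ α, ∑ β, (d α β + e α β) * relator x u r α β =
        ∑ α, ∑ β, d α β * (X (x α) * X (u β)) + ∑ α, ∑ β, d α β * r α β +
          ∑ α, ∑ β, e α β * relator x u r α β := by
      simp only [← Finset.sum_add_distrib]
      refine Finset.sum_congr rfl fun α _ => Finset.sum_congr rfl fun β _ => ?_
      unfold relator
      ring
    rw [h2]
    linear_combination h1 + heq

/-- A multiple of a minor is, modulo relations with cofactors of no larger weight, a combination of
minors. -/
theorem exists_minor_mul_eq (h : Blocks x u r) {w : σ → ℕ} (hwx : ∀ α, w (x α) = 1)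
    (hwu : ∀ β, w (u β) = 1) (hr : ∀ α β, WeightLT w 1 (r α β)) (n : ℕ) (f : MvPolynomial σ K)
    (hf : WeightLT w n f) (β : Fin 2) :
    ∃ s, IsMinorComb x u r s ∧ ∃ c : Fin 2 → Fin 2 → MvPolynomial σ K,
      (∀ α β, WeightLT w n (c α β)) ∧
      blockMinor x r β * f = s + ∑ α, ∑ β, c α β * relator x u r α β := by
  rcases Nat.eq_zero_or_pos n with rfl | hn
  · rw [hf.eq_zero]
    exact ⟨0, isMinorComb_zero, 0, fun _ _ => weightLT_zero _, by simp⟩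
  obtain ⟨P, hP, Q, hQ, c, hPw, hQw, hcw, rfl⟩ := exists_normal_form h hwx hwu hr n f hf
  obtain ⟨P₀, hP₀, a, ha, haw, rfl⟩ := exists_eq_add_sum_X_mul h hwu hP hPw
  have hminor : WeightLT w (1 + 1) (blockMinor x r β) := by
    have hX (α : Fin 2) : WeightLT w 2 (X (x α) : MvPolynomial σ K) :=
      (isWeightHomog_X (x α)).weightLT (by rw [hwx]; omega)
    exact ((hX 1).mul (hr 0 β)).sub ((hX 0).mul (hr 1 β))
  have hcw' (α γ) : WeightLT w n (c α γ * blockMinor x r β) :=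
    ((hcw α γ).mul hminor).mono (by omega)
  have haw' (α γ δ) : WeightLT w n (a γ * r α δ) :=
    ((haw γ).mul (hr α δ)).mono (by omega)
  -- `blockMinor β * u_γ` equals `± det r` modulo the relations when `γ ≠ β`, and `0` otherwise.
  refine ⟨blockMinor x r β * (P₀ + Q) + blockDet r * ![-a 1, a 0] β,
    (isMinorComb_minor_mul (add_mem hP₀.2 hQ) β).add (isMinorComb_det_mul h ?_),
    fun α γ => c α γ * blockMinor x r β + ![-(a γ * r 1 β), a γ * r 0 β] α, fun α γ => ?_, ?_⟩
  · fin_cases β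
    · exact neg_mem (ha 1)
    · exact ha 0
  · refine (hcw' α γ).add ?_
    fin_cases α
    · exact (haw' 1 γ β).neg
    · exact haw' 0 γ β
  · fin_cases β <;> simp [Fin.sum_univ_two, blockDet, blockMinor, relator] <;> ring

/-! ### Syzygies of the products of two blocks -/

theorem exists_of_X_mul_add_X_mul_eq_zero [IsDomain K] {i j : σ} (hij : i ≠ j)
    {a b : MvPolynomial σ K} (h : a * X i + b * X j = 0) :
    ∃ k, a = X j * k ∧ b = -(X i * k) := by
  have hdvd : X j ∣ a * X i := ⟨-b, by linear_combination h⟩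
  have hX : ¬ (X j : MvPolynomial σ K) ∣ X i := by
    rintro ⟨k, hk⟩
    classical
    have := congrArg (eval fun l => if l = i then (1 : K) else 0) hk
    simp [hij.symm] at this
  obtain ⟨k, rfl⟩ := (X_prime.dvd_or_dvd hdvd).resolve_right hX
  refine ⟨k, rfl, ?_⟩
  have h0 : (X j : MvPolynomial σ K) ≠ 0 := X_ne_zero j
  apply mul_right_cancel₀ h0
  linear_combination h

theorem exists_syzygy [IsDomain K] (h : Blocks x u r) {f : Fin 2 → Fin 2 → MvPolynomial σ K}
    (hf : ∑ α, ∑ β, f α β * (X (x α) * X (u β)) = 0) :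
    ∃ a b : Fin 2 → MvPolynomial σ K,
      f 0 0 = a 0 * X (x 1) + b 0 * X (u 1) ∧ f 0 1 = a 1 * X (x 1) - b 0 * X (u 0) ∧
      f 1 0 = b 1 * X (u 1) - a 0 * X (x 0) ∧ f 1 1 = -(a 1 * X (x 0)) - b 1 * X (u 0) := by
  have hx : x 0 ≠ x 1 := fun h' => by simpa using h.injective_left h'
  have hu : u 0 ≠ u 1 := fun h' => by simpa using h.injective_right h'
  obtain ⟨k, hk0, hk1⟩ := exists_of_X_mul_add_X_mul_eq_zero hx
    (a := f 0 0 * X (u 0) + f 0 1 * X (u 1)) (b := f 1 0 * X (u 0) + f 1 1 * X (u 1)) (by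
      simp only [Fin.sum_univ_two] at hf
      linear_combination hf)
  have hk : killBlock u k = 0 := by
    have h1 := congrArg (killBlock u) hk0
    simp only [map_add, map_mul, killBlock_X_mem, mul_zero, add_zero,
      killBlock_X_of_notMem fun β => (h.disjoint 1 β).symm] at h1
    exact (mul_eq_zero.1 h1.symm).resolve_left (X_ne_zero _)
  obtain ⟨a, ha⟩ := exists_sub_killBlock_eq u k
  rw [hk, sub_zero, Fin.sum_univ_two] at ha
  obtain ⟨b0, hb0, hb0'⟩ := exists_of_X_mul_add_X_mul_eq_zero hu
    (a := f 0 0 - a 0 * X (x 1)) (b := f 0 1 - a 1 * X (x 1)) (by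
      linear_combination hk0 + X (x 1) * ha)
  obtain ⟨b1, hb1, hb1'⟩ := exists_of_X_mul_add_X_mul_eq_zero hu
    (a := f 1 0 + a 0 * X (x 0)) (b := f 1 1 + a 1 * X (x 0)) (by
      linear_combination hk1 - X (x 0) * ha)
  refine ⟨a, ![b0, b1], ?_, ?_, ?_, ?_⟩
  · simp; linear_combination hb0
  · simp; linear_combination hb0'
  · simp; linear_combination hb1
  · simp; linear_combination hb1'

/-! ### Unmixed elements of the ideal of relations -/

theorem IsUnmixed.sub {f g : MvPolynomial σ K} (hf : IsUnmixed x u f) (hg : IsUnmixed x u g) :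
    IsUnmixed x u (f - g) := by
  obtain ⟨P, hP, Q, hQ, rfl⟩ := hf
  obtain ⟨P', hP', Q', hQ', rfl⟩ := hg
  exact ⟨P - P', sub_mem hP hP', Q - Q', sub_mem hQ hQ', by ring⟩

theorem IsMinorComb.isUnmixed (h : Blocks x u r) {f : MvPolynomial σ K}
    (hf : IsMinorComb x u r f) : IsUnmixed x u f := by
  obtain ⟨B, hB, P, Q, hP, hQ, rfl⟩ := hf
  have hXx (α) : (X (x α) : MvPolynomial σ K) ∈ freeOf K u :=
    killBlock_X_of_notMem fun β => (h.disjoint α β).symm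
  have hXu (β) : (X (u β) : MvPolynomial σ K) ∈ freeOf K x :=
    killBlock_X_of_notMem fun α => h.disjoint α β
  refine ⟨blockDet r * B + ∑ α, blockMinor u (fun α β => r β α) α * P α, ?_,
    ∑ β, blockMinor x r β * Q β, ?_, rfl⟩
  · refine add_mem (mul_mem (sub_mem ?_ ?_) hB.1) (sum_mem fun α _ => mul_mem (sub_mem ?_ ?_) (hP α))
    · exact mul_mem (h.mem_left _ _) (h.mem_left _ _)
    · exact mul_mem (h.mem_left _ _) (h.mem_left _ _)
    · exact mul_mem (hXu _) (h.mem_left _ _)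
    · exact mul_mem (hXu _) (h.mem_left _ _)
  · refine sum_mem fun β _ => mul_mem (sub_mem ?_ ?_) (hQ β)
    · exact mul_mem (hXx _) (h.mem_right _ _)
    · exact mul_mem (hXx _) (h.mem_right _ _)

theorem IsUnmixed.weightComp_eq_zero {w : σ → ℕ} {n : ℕ}
    {f : MvPolynomial σ K} (hf : IsUnmixed x u f) {c : Fin 2 → Fin 2 → MvPolynomial σ K}
    (hc : weightComp w n f = ∑ α, ∑ β, c α β * (X (x α) * X (u β))) : weightComp w n f = 0 := by
  obtain ⟨P, hP, Q, hQ, rfl⟩ := hf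
  have hx : killBlock x (weightComp w n (P + Q)) = 0 := by
    rw [hc]
    simp [killBlock_X_mem]
  have hu : killBlock u (weightComp w n (P + Q)) = 0 := by
    rw [hc]
    simp [killBlock_X_mem]
  have hxu : killBlock x (killBlock u (weightComp w n (P + Q))) = 0 := by rw [hu, map_zero]
  rw [← weightComp_killBlock, map_add, mem_freeOf.1 hP, map_add] at hx
  rw [← weightComp_killBlock, map_add, mem_freeOf.1 hQ, map_add] at hu
  rw [← weightComp_killBlock, ← weightComp_killBlock, map_add, map_add, mem_freeOf.1 hQ,
    killBlock_comm, mem_freeOf.1 hP, map_add] at hxu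
  rw [map_add]
  linear_combination hx + hu - hxu

/-- The unmixed elements of the ideal of relations are the combinations of minors. By induction on
the weight of the cofactors: their top components are a syzygy of the products `x_α u_β`, so the
combination can be rewritten, up to combinations of minors, with cofactors of smaller weight. -/
theorem isMinorComb_of_isUnmixed_of_weightLT [IsDomain K] (h : Blocks x u r) {w : σ → ℕ}
    (hwx : ∀ α, w (x α) = 1) (hwu : ∀ β, w (u β) = 1) (hr : ∀ α β, WeightLT w 1 (r α β)) (n : ℕ)
    (c : Fin 2 → Fin 2 → MvPolynomial σ K) (hc : ∀ α β, WeightLT w n (c α β))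
    (hF : IsUnmixed x u (∑ α, ∑ β, c α β * relator x u r α β)) :
    IsMinorComb x u r (∑ α, ∑ β, c α β * relator x u r α β) := by
  induction n generalizing c with
  | zero =>
    simp only [(hc _ _).eq_zero, zero_mul, Finset.sum_const_zero]
    exact isMinorComb_zero
  | succ n ih =>
    set t : Fin 2 → Fin 2 → MvPolynomial σ K := fun α β => weightComp w n (c α β) with ht
    have hXX (α β) : IsWeightHomog w 2 (X (x α) * X (u β) : MvPolynomial σ K) := by
      have := (isWeightHomog_X (K := K) (w := w) (x α)).mul (isWeightHomog_X (w := w) (u β))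
      rwa [hwx, hwu] at this
    have hlead : weightComp w (n + 2) (∑ α, ∑ β, c α β * relator x u r α β) =
        ∑ α, ∑ β, t α β * (X (x α) * X (u β)) := by
      simp_rw [map_sum]
      refine Finset.sum_congr rfl fun α _ => Finset.sum_congr rfl fun β _ => ?_
      rw [relator, mul_add, map_add, (hXX α β).weightComp_mul, if_pos (by omega),
        ((hc α β).mul (hr α β)) (n + 2) (by omega), add_zero, Nat.add_sub_cancel]
    obtain ⟨a, b, h00, h01, h10, h11⟩ := exists_syzygy h
      (hlead.symm.trans (hF.weightComp_eq_zero hlead))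
    -- The top components are homogeneous of weight `n`, so `a` and `b` can be taken homogeneous of
    -- weight `n - 1`; for `n = 0` they vanish.
    set d : MvPolynomial σ K → MvPolynomial σ K :=
      fun f => if 1 ≤ n then weightComp w (n - 1) f else 0 with hd
    have hdw (f) : WeightLT w n (d f) := by
      simp only [hd]
      split_ifs with h1
      · exact (isWeightHomog_weightComp _ _).weightLT (by omega)
      · exact weightLT_zero n
    have hX (f : MvPolynomial σ K) (i : σ) (hi : w i = 1) :
        weightComp w n (f * X i) = d f * X i := by
      have h1 : IsWeightHomog w 1 (X i : MvPolynomial σ K) := by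
        simpa only [hi] using isWeightHomog_X (K := K) (w := w) i
      rw [h1.weightComp_mul]
      simp only [hd]
      split_ifs <;> simp
    have htop (α β) : weightComp w n (t α β) = t α β := by
      rw [ht]
      simp only
      rw [(isWeightHomog_weightComp _ _).weightComp_eq, if_pos rfl]
    have k00 := congrArg (weightComp w n) h00
    have k01 := congrArg (weightComp w n) h01
    have k10 := congrArg (weightComp w n) h10
    have k11 := congrArg (weightComp w n) h11
    simp only [htop, map_add, map_sub, map_neg, hX _ _ (hwx _), hX _ _ (hwu _)]
      at k00 k01 k10 k11
    obtain ⟨s0, hs0, c0, hc0, e0⟩ := exists_minor_mul_eq h hwx hwu hr n _ (hdw (a 0)) 0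
    obtain ⟨s1, hs1, c1, hc1, e1⟩ := exists_minor_mul_eq h hwx hwu hr n _ (hdw (a 1)) 1
    obtain ⟨s2, hs2, c2, hc2, e2⟩ := exists_minor_mul_eq h.symm hwu hwx (fun α β => hr β α) n _
      (hdw (b 0)) 0
    obtain ⟨s3, hs3, c3, hc3, e3⟩ := exists_minor_mul_eq h.symm hwu hwx (fun α β => hr β α) n _
      (hdw (b 1)) 1
    have hs : IsMinorComb x u r (s0 + s1 + s2 + s3) :=
      ((hs0.add hs1).add hs2.symm).add hs3.symm
    set c' : Fin 2 → Fin 2 → MvPolynomial σ K := fun α β =>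
      (c α β - t α β) + c0 α β + c1 α β + c2 β α + c3 β α with hc'
    have heq : ∑ α, ∑ β, c α β * relator x u r α β =
        (s0 + s1 + s2 + s3) + ∑ α, ∑ β, c' α β * relator x u r α β := by
      simp only [hc', Fin.sum_univ_two, relator, blockMinor] at e0 e1 e2 e3 ⊢
      linear_combination e0 + e1 + e2 + e3 + (X (x 0) * X (u 0) + r 0 0) * k00 +
        (X (x 0) * X (u 1) + r 0 1) * k01 + (X (x 1) * X (u 0) + r 1 0) * k10 +
        (X (x 1) * X (u 1) + r 1 1) * k11
    have hmain : IsMinorComb x u r (∑ α, ∑ β, c' α β * relator x u r α β) := by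
      refine ih c' (fun α β => ?_) ?_
      · exact (((((hc α β).sub_weightComp).add (hc0 α β)).add (hc1 α β)).add (hc2 β α)).add
          (hc3 β α)
      · have h1 := hF.sub (hs.isUnmixed h)
        rwa [heq, add_sub_cancel_left] at h1
    rw [heq]
    exact hs.add hmain

open Classical in
/-- The weight that is `1` on the two blocks and `0` on the other variables. -/
noncomputable def blockWeight (x u : Fin 2 → σ) (i : σ) : ℕ :=
  if i ∈ Set.range x ∨ i ∈ Set.range u then 1 else 0

theorem weightLT_blockWeight {f : MvPolynomial σ K} (hx : f ∈ freeOf K x) (hu : f ∈ freeOf K u) :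
    WeightLT (blockWeight x u) 1 f := by
  rw [← mem_freeOf.1 hx, ← mem_freeOf.1 hu]
  clear hx hu
  induction f using MvPolynomial.induction_on with
  | C a =>
    rw [← MvPolynomial.algebraMap_eq, AlgHom.commutes, AlgHom.commutes]
    exact (isWeightHomog_C a).weightLT Nat.one_pos
  | add p q hp hq => rw [map_add, map_add]; exact hp.add hq
  | mul_X p i hp =>
    rw [map_mul, map_mul]
    refine (hp.mul (b := 0) ?_).mono le_rfl
    by_cases hi : ∃ β, u β = i
    · obtain ⟨β, rfl⟩ := hi
      rw [killBlock_X_mem, map_zero]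
      exact weightLT_zero _
    by_cases hi' : ∃ α, x α = i
    · obtain ⟨α, rfl⟩ := hi'
      rw [killBlock_comm, killBlock_X_mem, map_zero]
      exact weightLT_zero _
    rw [killBlock_X_of_notMem (not_exists.1 hi), killBlock_X_of_notMem (not_exists.1 hi')]
    refine (isWeightHomog_X i).weightLT ?_
    rw [blockWeight, if_neg (by simp [Set.mem_range, hi, hi'])]
    exact Nat.one_pos

theorem exists_unmixed_add_relators (h : Blocks x u r) (f : MvPolynomial σ K) :
    ∃ P ∈ freeOf K x, ∃ Q ∈ freeOf K u, ∃ c : Fin 2 → Fin 2 → MvPolynomial σ K,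
      f = P + Q + ∑ α, ∑ β, c α β * relator x u r α β := by
  obtain ⟨n, hn⟩ := exists_weightLT (w := blockWeight x u) f
  obtain ⟨P, hP, Q, hQ, c, -, -, -, hf⟩ := exists_normal_form h (w := blockWeight x u)
    (by simp [blockWeight]) (by simp [blockWeight])
    (fun α β => weightLT_blockWeight (h.mem_left α β) (h.mem_right α β)) n f hn
  exact ⟨P, hP, Q, hQ, c, hf⟩

theorem isMinorComb_of_isUnmixed [IsDomain K] (h : Blocks x u r)
    (c : Fin 2 → Fin 2 → MvPolynomial σ K)
    (hF : IsUnmixed x u (∑ α, ∑ β, c α β * relator x u r α β)) :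
    IsMinorComb x u r (∑ α, ∑ β, c α β * relator x u r α β) := by
  choose n hn using fun α β => exists_weightLT (w := blockWeight x u) (c α β)
  refine isMinorComb_of_isUnmixed_of_weightLT h (by simp [blockWeight]) (by simp [blockWeight])
    (fun α β => weightLT_blockWeight (h.mem_left α β) (h.mem_right α β))
    (∑ α, ∑ β, n α β) c (fun α β => (hn α β).mono ?_) hF
  exact (Finset.single_le_sum (f := n α) (fun _ _ => Nat.zero_le _) (Finset.mem_univ β)).trans
    (Finset.single_le_sum (f := fun α => ∑ β, n α β) (fun _ _ => Nat.zero_le _)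
      (Finset.mem_univ α))

end Blocks

/-! ### The standard spinor representation -/


/-- The gamma matrices of the standard representation in Euclidean signature. -/
noncomputable def euclideanGamma : Fin 4 → Matrix (Fin 4) (Fin 4) ℂ :=
  ![!![0, 0, 1, 0; 0, 0, 0, 1; 1, 0, 0, 0; 0, 1, 0, 0],
    !![0, 0, -Complex.I, 0; 0, 0, 0, -Complex.I; Complex.I, 0, 0, 0; 0, Complex.I, 0, 0],
    !![0, 1, 0, 0; 1, 0, 0, 0; 0, 0, 0, -1; 0, 0, -1, 0],
    !![0, -Complex.I, 0, 0; Complex.I, 0, 0, 0; 0, 0, 0, Complex.I; 0, 0, -Complex.I, 0]]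

theorem kron_apply (A B : Matrix (Fin 2) (Fin 2) ℂ) :
    kron A B = !![A 0 0 * B 0 0, A 0 0 * B 0 1, A 0 1 * B 0 0, A 0 1 * B 0 1;
      A 0 0 * B 1 0, A 0 0 * B 1 1, A 0 1 * B 1 0, A 0 1 * B 1 1;
      A 1 0 * B 0 0, A 1 0 * B 0 1, A 1 1 * B 0 0, A 1 1 * B 0 1;
      A 1 0 * B 1 0, A 1 0 * B 1 1, A 1 1 * B 1 0, A 1 1 * B 1 1] := by
  ext i j
  fin_cases i <;> fin_cases j <;> rfl

theorem standardRep_gamma (t : ℕ) (a : Fin 4) :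
    (standardRep t).gamma a = kFactor t a • euclideanGamma a := by
  fin_cases a <;> simp [standardRep, euclideanGamma, kron_apply, pauli1, pauli2, pauli3]

theorem standardRep_chir (t : ℕ) :
    (standardRep t).chir = Matrix.diagonal ![1, -1, -1, 1] := by
  ext i j
  fin_cases i <;> fin_cases j <;> simp [standardRep, kron_apply, pauli3]

theorem standardRep_conj (t : ℕ) :
    (standardRep t).conj = !![0, 0, 0, -Complex.I; 0, 0, -Complex.I, 0;
      0, Complex.I, 0, 0; Complex.I, 0, 0, 0] := by
  simp [standardRep, kron_apply, pauli1, pauli2]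

theorem standardRep_conj_inv (t : ℕ) :
    (standardRep t).conj⁻¹ = !![0, 0, 0, -Complex.I; 0, 0, -Complex.I, 0;
      0, Complex.I, 0, 0; Complex.I, 0, 0, 0] := by
  apply Matrix.inv_eq_left_inv
  rw [standardRep_conj]
  ext i j
  fin_cases i <;> fin_cases j <;> simp [Matrix.mul_apply, Fin.sum_univ_four]

theorem standardRep_projPlus (t : ℕ) :
    (1 / 2 : ℂ) • (1 + (standardRep t).chir) = Matrix.diagonal ![1, 0, 0, 1] := by
  rw [standardRep_chir]
  ext i j
  fin_cases i <;> fin_cases j <;> norm_num [Matrix.one_apply]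

theorem standardRep_projMinus (t : ℕ) :
    (1 / 2 : ℂ) • (1 - (standardRep t).chir) = Matrix.diagonal ![0, 1, 1, 0] := by
  rw [standardRep_chir]
  ext i j
  fin_cases i <;> fin_cases j <;> norm_num [Matrix.one_apply]

theorem metricSign_mul_kFactor_mul_kFactor (t : ℕ) (a : Fin 4) :
    metricSign t a * kFactor t a * kFactor t a = 1 := by
  unfold metricSign kFactor
  split_ifs <;> simp

/-! ### The coboundary operator as a contraction -/

section

variable (t : ℕ) (ρ : SpinorRep) {N : ℕ}

/-- The quadratic form `∑_i A_{αβ} ξ_i^α ξ_i^β`. -/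
noncomputable def quadForm (N : ℕ) (A : Matrix (Fin 4) (Fin 4) ℂ) : SusyPoly N :=
  ∑ i : Fin N, ∑ α : Fin 4, ∑ β : Fin 4, const (A α β) * xi i α * xi i β

/-- The value of the coboundary operator on `c^a`. -/
noncomputable def ghCoeff (N : ℕ) (a : Fin 4) : SusyPoly N :=
  quadForm N ((Complex.I / 2) • ((metricSign t a • ρ.gamma a) * ρ.conj⁻¹))

/-- The functional on `Fin 4 → SusyPoly N` contraction with which is the coboundary operator. -/
noncomputable def ghDual (N : ℕ) : Module.Dual (SusyPoly N) (Fin 4 → SusyPoly N) :=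
  ∑ a : Fin 4, ghCoeff t ρ N a • LinearMap.proj a

theorem gh_eq_contr : gh t ρ (N := N) = contr (ghDual t ρ N) := by
  rw [gh, ghDual]
  refine LinearMap.ext fun ω => ?_
  rw [contr_sum_smul, LinearMap.sum_apply]
  refine Finset.sum_congr rfl fun a _ => ?_
  rw [LinearMap.smul_apply, ghCoeff, quadForm]
  change _ = _ • transDeriv a ω
  congr 1
  refine Finset.sum_congr rfl fun i _ => ?_
  rw [Finset.sum_eq_single i]
  · refine Finset.sum_congr rfl fun α _ => Finset.sum_congr rfl fun β _ => ?_
    congr 3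
    simp only [susyMatrix, Matrix.smul_apply, Matrix.one_apply_eq, smul_eq_mul]
    ring
  · intro j _ hj
    refine Finset.sum_eq_zero fun α _ => Finset.sum_eq_zero fun β _ => ?_
    simp [susyMatrix, Matrix.one_apply_ne hj.symm]
  · simp

theorem ofSusy_sum {κ : Type*} (s : Finset κ) (f : κ → SusyPoly N) :
    ofSusy (∑ i ∈ s, f i) = ∑ i ∈ s, ofSusy (f i) := map_sum _ _ _

theorem ofSusy_add (p q : SusyPoly N) : ofSusy (p + q) = ofSusy p + ofSusy q := map_add _ _ _

theorem ofSusy_sub (p q : SusyPoly N) : ofSusy (p - q) = ofSusy p - ofSusy q := map_sub _ _ _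

theorem gh_smul_of_eq {ω : GhostPoly N} {m : SusyPoly N} (h : gh t ρ ω = ofSusy m)
    (p : SusyPoly N) : gh t ρ (p • ω) = ofSusy (p * m) := by
  rw [map_smul, h, Algebra.smul_def, ← map_mul]

theorem gh_smul_transGhost (m : SusyPoly N) (a : Fin 4) :
    gh t ρ (m • transGhost a) = ofSusy (m * ghCoeff t ρ N a) := by
  rw [gh_eq_contr, map_smul, transGhost, contr_ι, Algebra.smul_def, ← map_mul]
  congr 2
  simp [ghDual, Pi.single_apply]

/-- The value of the coboundary operator on `ϑ_i^α`. -/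
noncomputable def ghVtheta (i : Fin N) (α : Fin 4) : SusyPoly N :=
  ∑ a : Fin 4, (∑ β : Fin 4, const (ρ.gamma a β α) * xi i β) * ghCoeff t ρ N a

/-- The value of the coboundary operator on `ϑ_i^{+α}`. -/
noncomputable def ghVthetaPlus (i : Fin N) (α : Fin 4) : SusyPoly N :=
  ∑ β : Fin 4, const (((1 / 2 : ℂ) • (1 + ρ.chir)) β α) * ghVtheta t ρ i β

/-- The value of the coboundary operator on `ϑ_i^{-α}`. -/
noncomputable def ghVthetaMinus (i : Fin N) (α : Fin 4) : SusyPoly N :=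
  ∑ β : Fin 4, const (((1 / 2 : ℂ) • (1 - ρ.chir)) β α) * ghVtheta t ρ i β

theorem gh_vtheta (i : Fin N) (α : Fin 4) :
    gh t ρ (vtheta ρ i α) = ofSusy (ghVtheta t ρ i α) := by
  rw [vtheta, ghVtheta, ofSusy_sum, map_sum]
  exact Finset.sum_congr rfl fun a _ => gh_smul_transGhost t ρ _ a

theorem gh_vthetaPlus (i : Fin N) (α : Fin 4) :
    gh t ρ (vthetaPlus ρ i α) = ofSusy (ghVthetaPlus t ρ i α) := by
  rw [vthetaPlus, ghVthetaPlus, ofSusy_sum, map_sum]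
  exact Finset.sum_congr rfl fun β _ => gh_smul_of_eq t ρ (gh_vtheta t ρ i β) _

theorem gh_vthetaMinus (i : Fin N) (α : Fin 4) :
    gh t ρ (vthetaMinus ρ i α) = ofSusy (ghVthetaMinus t ρ i α) := by
  rw [vthetaMinus, ghVthetaMinus, ofSusy_sum, map_sum]
  exact Finset.sum_congr rfl fun β _ => gh_smul_of_eq t ρ (gh_vtheta t ρ i β) _

theorem gh_bigTheta (i j : Fin N) :
    gh t ρ (bigTheta ρ i j) = ofSusy (spinorDot ρ (ghVthetaPlus t ρ i) (xiPlus ρ j)) := by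
  rw [bigTheta, spinorDot, ofSusy_sum, map_sum]
  refine Finset.sum_congr rfl fun α _ => ?_
  rw [ofSusy_sum, map_sum]
  refine Finset.sum_congr rfl fun β _ => ?_
  exact (gh_smul_of_eq t ρ (gh_vthetaPlus t ρ i α) _).trans (congrArg ofSusy (mul_right_comm _ _ _))

theorem gh_primitiveOf [NeZero N] (B : SusyPoly N) (P Q : Fin 4 → SusyPoly N) :
    gh t ρ (primitiveOf ρ B P Q) = ofSusy
      (B * (spinorDot ρ (ghVthetaPlus t ρ 0) (xiPlus ρ 0) -
          ∑ i ∈ Finset.univ.erase (0 : Fin N), spinorDot ρ (ghVthetaPlus t ρ i) (xiPlus ρ i)) +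
        ∑ α, P α * ghVthetaPlus t ρ 0 α + ∑ α, Q α * ghVthetaMinus t ρ 0 α) := by
  have hB : gh t ρ (bigTheta ρ 0 0 - ∑ i ∈ Finset.univ.erase (0 : Fin N), bigTheta ρ i i) =
      ofSusy (spinorDot ρ (ghVthetaPlus t ρ 0) (xiPlus ρ 0) -
        ∑ i ∈ Finset.univ.erase (0 : Fin N), spinorDot ρ (ghVthetaPlus t ρ i) (xiPlus ρ i)) := by
    rw [map_sub, map_sum, gh_bigTheta, ofSusy_sub]
    congr 1
    rw [ofSusy_sum]
    exact Finset.sum_congr rfl fun i _ => gh_bigTheta t ρ i i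
  have hP : gh t ρ (∑ α, P α • vthetaPlus ρ 0 α) = ofSusy (∑ α, P α * ghVthetaPlus t ρ 0 α) := by
    rw [map_sum, ofSusy_sum]
    exact Finset.sum_congr rfl fun α _ => gh_smul_of_eq t ρ (gh_vthetaPlus t ρ 0 α) _
  have hQ : gh t ρ (∑ α, Q α • vthetaMinus ρ 0 α) = ofSusy (∑ α, Q α * ghVthetaMinus t ρ 0 α) := by
    rw [map_sum, ofSusy_sum]
    exact Finset.sum_congr rfl fun α _ => gh_smul_of_eq t ρ (gh_vthetaMinus t ρ 0 α) _
  rw [primitiveOf, map_add, map_add, gh_smul_of_eq t ρ hB, hP, hQ, ofSusy_add, ofSusy_add]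

end

/-! ### Linear changes of the spinor basis -/

section ChangeOfBasis

open MvPolynomial

variable {N : ℕ}

/-- The substitution `ξ_i ↦ ξ_i A`, for all `i` (spinors are row vectors). -/
noncomputable def spinorSubst (N : ℕ) (A : Matrix (Fin 4) (Fin 4) ℂ) :
    SusyPoly N →ₐ[ℂ] SusyPoly N :=
  aeval fun x => ∑ β : Fin 4, const (A β x.2) * xi x.1 β

theorem spinorSubst_xi (A : Matrix (Fin 4) (Fin 4) ℂ) (i : Fin N) (α : Fin 4) :
    spinorSubst N A (xi i α) = ∑ β : Fin 4, const (A β α) * xi i β := by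
  simp [spinorSubst, xi]

theorem spinorSubst_const (A : Matrix (Fin 4) (Fin 4) ℂ) (z : ℂ) :
    spinorSubst N A (const z) = const z :=
  (spinorSubst N A).commutes z

theorem spinorSubst_sum_const_mul_xi (A B : Matrix (Fin 4) (Fin 4) ℂ) (i : Fin N) (α : Fin 4) :
    spinorSubst N A (∑ β, const (B β α) * xi i β) = ∑ β, const ((A * B) β α) * xi i β := by
  simp only [map_sum, map_mul, spinorSubst_const, spinorSubst_xi, Matrix.mul_apply, Finset.mul_sum,
    Finset.sum_mul, const]
  rw [Finset.sum_comm]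
  exact Finset.sum_congr rfl fun β _ => Finset.sum_congr rfl fun γ _ => by ring

theorem spinorSubst_comp (A B : Matrix (Fin 4) (Fin 4) ℂ) (p : SusyPoly N) :
    spinorSubst N A (spinorSubst N B p) = spinorSubst N (A * B) p := by
  have : (spinorSubst N A).comp (spinorSubst N B) = spinorSubst N (A * B) := by
    ext1 ⟨i, α⟩
    change spinorSubst N A (spinorSubst N B (xi i α)) = spinorSubst N (A * B) (xi i α)
    rw [spinorSubst_xi, spinorSubst_xi, spinorSubst_sum_const_mul_xi]
  exact DFunLike.congr_fun this p

theorem spinorSubst_one (p : SusyPoly N) : spinorSubst N 1 p = p := by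
  have : spinorSubst N 1 = AlgHom.id ℂ (SusyPoly N) := by
    ext1 ⟨i, α⟩
    change spinorSubst N 1 (xi i α) = xi i α
    rw [spinorSubst_xi]
    simp [Matrix.one_apply]
  exact DFunLike.congr_fun this p

/-- The substitution `ξ_i ↦ ξ_i S⁻¹` for an invertible matrix `S`. -/
noncomputable def spinorEquiv (N : ℕ) (S : Matrix (Fin 4) (Fin 4) ℂ) (hS : IsUnit S.det) :
    SusyPoly N ≃ₐ[ℂ] SusyPoly N :=
  AlgEquiv.ofAlgHom (spinorSubst N S⁻¹) (spinorSubst N S)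
    (AlgHom.ext fun p => by
      rw [AlgHom.comp_apply, spinorSubst_comp, Matrix.nonsing_inv_mul _ hS, spinorSubst_one]; rfl)
    (AlgHom.ext fun p => by
      rw [AlgHom.comp_apply, spinorSubst_comp, Matrix.mul_nonsing_inv _ hS, spinorSubst_one]; rfl)

theorem spinorEquiv_apply {S : Matrix (Fin 4) (Fin 4) ℂ} (hS : IsUnit S.det) (p : SusyPoly N) :
    spinorEquiv N S hS p = spinorSubst N S⁻¹ p := rfl

/-- The product `u S` of a spinor with a matrix. -/
noncomputable def spinorMul (S : Matrix (Fin 4) (Fin 4) ℂ) (u : Fin 4 → SusyPoly N) :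
    Fin 4 → SusyPoly N :=
  fun α => ∑ γ : Fin 4, const (S γ α) * u γ

theorem spinorMul_spinorMul (S T : Matrix (Fin 4) (Fin 4) ℂ) (u : Fin 4 → SusyPoly N) :
    spinorMul T (spinorMul S u) = spinorMul (S * T) u := by
  funext α
  simp only [spinorMul, Matrix.mul_apply, Finset.mul_sum, map_sum, map_mul, Finset.sum_mul, const]
  rw [Finset.sum_comm]
  exact Finset.sum_congr rfl fun β _ => Finset.sum_congr rfl fun γ _ => by ring

theorem spinorMul_one (u : Fin 4 → SusyPoly N) : spinorMul 1 u = u := by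
  funext α
  simp [spinorMul, Matrix.one_apply]

theorem spinorMul_mem {A : Subalgebra ℂ (SusyPoly N)} (T : Matrix (Fin 4) (Fin 4) ℂ)
    {u : Fin 4 → SusyPoly N} (hu : ∀ γ, u γ ∈ A) (α : Fin 4) : spinorMul T u α ∈ A :=
  sum_mem fun γ _ => mul_mem (A.algebraMap_mem (T γ α)) (hu γ)

theorem sum_spinorMul_mul_spinorMul_inv {S : Matrix (Fin 4) (Fin 4) ℂ} (hS : IsUnit S.det) (u v : Fin 4 → SusyPoly N) :
    ∑ α, spinorMul S u α * spinorMul S⁻¹.transpose v α = ∑ α, u α * v α := by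
  have h1 (w : Fin 4 → SusyPoly N) : ∑ α, w α * spinorMul S⁻¹.transpose v α =
      ∑ δ, spinorMul S⁻¹ w δ * v δ := by
    simp only [spinorMul, Finset.sum_mul, Finset.mul_sum, Matrix.transpose_apply]
    rw [Finset.sum_comm]
    exact Finset.sum_congr rfl fun δ _ => Finset.sum_congr rfl fun α _ => by ring
  rw [h1, spinorMul_spinorMul, Matrix.mul_nonsing_inv _ hS, spinorMul_one]

theorem spinorSubst_spinorMul (A S : Matrix (Fin 4) (Fin 4) ℂ) (u : Fin 4 → SusyPoly N)
    (α : Fin 4) :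
    spinorSubst N A (spinorMul S u α) = spinorMul S (fun γ => spinorSubst N A (u γ)) α := by
  simp only [spinorMul, map_sum, map_mul, spinorSubst_const]

theorem spinorSubst_xi_eq_spinorMul (A : Matrix (Fin 4) (Fin 4) ℂ) (i : Fin N) (α : Fin 4) :
    spinorSubst N A (xi i α) = spinorMul A (xi i) α :=
  spinorSubst_xi A i α

theorem xiPlus_eq (ρ : SpinorRep) (i : Fin N) :
    xiPlus ρ i = spinorMul ((1 / 2 : ℂ) • (1 + ρ.chir)) (xi i) := rfl

theorem xiMinus_eq (ρ : SpinorRep) (i : Fin N) :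
    xiMinus ρ i = spinorMul ((1 / 2 : ℂ) • (1 - ρ.chir)) (xi i) := rfl

theorem spinorSubst_quadForm (A B : Matrix (Fin 4) (Fin 4) ℂ) :
    spinorSubst N A (quadForm N B) = quadForm N (A * B * A.transpose) := by
  simp only [quadForm, map_sum, map_mul, spinorSubst_const, spinorSubst_xi, Matrix.mul_apply,
    Matrix.transpose_apply, const]
  refine Finset.sum_congr rfl fun i _ => ?_
  simp only [Fin.sum_univ_four]
  ring

variable {ρ ρ' : SpinorRep} {S : Matrix (Fin 4) (Fin 4) ℂ}

/-- The representation `ρ'` arises from `ρ` by the change of basis `S`. -/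
structure ChangesBy (S : Matrix (Fin 4) (Fin 4) ℂ) (ρ ρ' : SpinorRep) : Prop where
  isUnit : IsUnit S.det
  gamma : ∀ a, ρ'.gamma a = S⁻¹ * ρ.gamma a * S
  chir : ρ'.chir = S⁻¹ * ρ.chir * S
  conj : ρ'.conj = S.transpose * ρ.conj * S

namespace ChangesBy

theorem conj_inv (h : ChangesBy S ρ ρ') :
    ρ'.conj⁻¹ = S⁻¹ * ρ.conj⁻¹ * S⁻¹.transpose := by
  rw [h.conj, Matrix.mul_inv_rev, Matrix.mul_inv_rev, Matrix.transpose_nonsing_inv, mul_assoc]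

theorem projPlus (h : ChangesBy S ρ ρ') :
    (1 / 2 : ℂ) • (1 + ρ'.chir) = S⁻¹ * ((1 / 2 : ℂ) • (1 + ρ.chir)) * S := by
  rw [h.chir, Matrix.mul_smul, Matrix.smul_mul, mul_add, add_mul, mul_one,
    Matrix.nonsing_inv_mul _ h.isUnit]

theorem projMinus (h : ChangesBy S ρ ρ') :
    (1 / 2 : ℂ) • (1 - ρ'.chir) = S⁻¹ * ((1 / 2 : ℂ) • (1 - ρ.chir)) * S := by
  rw [h.chir, Matrix.mul_smul, Matrix.smul_mul, mul_sub, sub_mul, mul_one,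
    Matrix.nonsing_inv_mul _ h.isUnit]

theorem mul_inv_mul (h : ChangesBy S ρ ρ') (A : Matrix (Fin 4) (Fin 4) ℂ) :
    S * (S⁻¹ * A) = A := Matrix.mul_nonsing_inv_cancel_left _ _ h.isUnit

theorem spinorMul_xi (h : ChangesBy S ρ ρ') (A : Matrix (Fin 4) (Fin 4) ℂ) (i : Fin N) :
    spinorMul (S⁻¹ * A * S) (xi i) =
      spinorMul S fun γ => spinorEquiv N S h.isUnit (spinorMul A (xi i) γ) := by
  have h1 (γ : Fin 4) : spinorEquiv N S h.isUnit (spinorMul A (xi i) γ) =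
      spinorMul (S⁻¹ * A) (xi i) γ := by
    rw [spinorEquiv_apply, spinorSubst_spinorMul, ← spinorMul_spinorMul]
    congr 1
    funext γ
    exact spinorSubst_xi_eq_spinorMul _ _ _
  simp only [h1]
  rw [← spinorMul_spinorMul]

theorem xiPlus (h : ChangesBy S ρ ρ') (i : Fin N) :
    xiPlus ρ' i = spinorMul S fun γ => spinorEquiv N S h.isUnit (xiPlus ρ i γ) := by
  rw [xiPlus_eq, h.projPlus, h.spinorMul_xi]
  rfl

theorem xiMinus (h : ChangesBy S ρ ρ') (i : Fin N) :
    xiMinus ρ' i = spinorMul S fun γ => spinorEquiv N S h.isUnit (xiMinus ρ i γ) := by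
  rw [xiMinus_eq, h.projMinus, h.spinorMul_xi]
  rfl

theorem ghCoeff (h : ChangesBy S ρ ρ') (t : ℕ) (a : Fin 4) :
    ghCoeff t ρ' N a = spinorEquiv N S h.isUnit (ghCoeff t ρ N a) := by
  rw [spinorEquiv_apply, SusyCohomology.ghCoeff, SusyCohomology.ghCoeff, spinorSubst_quadForm,
    h.gamma, h.conj_inv]
  congr 1
  simp only [Matrix.smul_mul, Matrix.mul_smul, mul_assoc, h.mul_inv_mul]

theorem ghVtheta (h : ChangesBy S ρ ρ') (t : ℕ) (i : Fin N) :
    ghVtheta t ρ' i = spinorMul S fun γ => spinorEquiv N S h.isUnit (ghVtheta t ρ i γ) := by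
  funext α
  have h1 (a : Fin 4) : ∑ β : Fin 4, const (ρ'.gamma a β α) * xi (N := N) i β =
      spinorMul S (fun γ => spinorEquiv N S h.isUnit (spinorMul (ρ.gamma a) (xi i) γ)) α := by
    rw [← h.spinorMul_xi, ← h.gamma]
    rfl
  simp only [SusyCohomology.ghVtheta, h1, h.ghCoeff, map_sum, map_mul]
  simp only [spinorMul, Finset.sum_mul, Finset.mul_sum, map_sum, map_mul]
  rw [Finset.sum_comm]
  refine Finset.sum_congr rfl fun γ _ => Finset.sum_congr rfl fun a _ =>
    Finset.sum_congr rfl fun β _ => by ring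

theorem spinorMul_equiv (h : ChangesBy S ρ ρ') (A : Matrix (Fin 4) (Fin 4) ℂ)
    (u : Fin 4 → SusyPoly N) :
    spinorMul (S⁻¹ * A * S) (spinorMul S fun γ => spinorEquiv N S h.isUnit (u γ)) =
      spinorMul S fun γ => spinorEquiv N S h.isUnit (spinorMul A u γ) := by
  have h1 (γ : Fin 4) : spinorEquiv N S h.isUnit (spinorMul A u γ) =
      spinorMul A (fun δ => spinorEquiv N S h.isUnit (u δ)) γ := spinorSubst_spinorMul _ _ _ _
  simp only [h1]
  rw [spinorMul_spinorMul, spinorMul_spinorMul, mul_assoc, h.mul_inv_mul]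

theorem ghVthetaPlus (h : ChangesBy S ρ ρ') (t : ℕ) (i : Fin N) :
    ghVthetaPlus t ρ' i =
      spinorMul S fun γ => spinorEquiv N S h.isUnit (ghVthetaPlus t ρ i γ) := by
  change spinorMul _ (SusyCohomology.ghVtheta t ρ' i) = _
  rw [h.projPlus, h.ghVtheta, h.spinorMul_equiv]
  rfl

theorem ghVthetaMinus (h : ChangesBy S ρ ρ') (t : ℕ) (i : Fin N) :
    ghVthetaMinus t ρ' i =
      spinorMul S fun γ => spinorEquiv N S h.isUnit (ghVthetaMinus t ρ i γ) := by
  change spinorMul _ (SusyCohomology.ghVtheta t ρ' i) = _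
  rw [h.projMinus, h.ghVtheta, h.spinorMul_equiv]
  rfl

theorem spinorDot (h : ChangesBy S ρ ρ') (u v : Fin 4 → SusyPoly N) :
    spinorDot ρ' (spinorMul S fun γ => spinorEquiv N S h.isUnit (u γ))
        (spinorMul S fun γ => spinorEquiv N S h.isUnit (v γ)) =
      spinorEquiv N S h.isUnit (spinorDot ρ u v) := by
  have h1 : ρ.conj⁻¹ = S * ρ'.conj⁻¹ * S.transpose := by
    rw [h.conj_inv, mul_assoc, mul_assoc, ← Matrix.transpose_mul,
      Matrix.mul_nonsing_inv _ h.isUnit, Matrix.transpose_one, mul_one, h.mul_inv_mul]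
  have h2 (z : ℂ) : spinorEquiv N S h.isUnit (const z) = const z := spinorSubst_const _ z
  simp only [SusyCohomology.spinorDot, map_sum, map_mul, h2, h1, spinorMul, Matrix.mul_apply,
    Matrix.transpose_apply, const]
  simp only [Fin.sum_univ_four]
  ring

end ChangesBy

end ChangeOfBasis

/-! ### The coboundary operator in the standard representation -/


section Standard

open MvPolynomial

variable {N : ℕ} (t : ℕ)

theorem const_I_mul_const_I : (const Complex.I * const Complex.I : SusyPoly N) = -1 := by
  rw [const, ← map_mul, Complex.I_mul_I, map_neg, map_one]

theorem xiPlus_standardRep (i : Fin N) :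
    xiPlus (standardRep t) i = ![xi i 0, 0, 0, xi i 3] := by
  rw [xiPlus_eq, standardRep_projPlus]
  funext α
  fin_cases α <;> simp [spinorMul, Fin.sum_univ_four]

theorem xiMinus_standardRep (i : Fin N) :
    xiMinus (standardRep t) i = ![0, xi i 1, xi i 2, 0] := by
  rw [xiMinus_eq, standardRep_projMinus]
  funext α
  fin_cases α <;> simp [spinorMul, Fin.sum_univ_four]

theorem spinorDot_standardRep (u v : Fin 4 → SusyPoly N) :
    spinorDot (standardRep t) u v =
      const Complex.I * (u 3 * v 0 + u 2 * v 1 - u 0 * v 3 - u 1 * v 2) := by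
  rw [spinorDot, standardRep_conj_inv]
  simp [Fin.sum_univ_four]
  ring

theorem quadForm_smul (z : ℂ) (A : Matrix (Fin 4) (Fin 4) ℂ) :
    quadForm N (z • A) = const z * quadForm N A := by
  simp only [quadForm, Finset.mul_sum, Matrix.smul_apply, smul_eq_mul, const, map_mul]
  exact Finset.sum_congr rfl fun i _ => Finset.sum_congr rfl fun α _ =>
    Finset.sum_congr rfl fun β _ => by ring

/-- The values of the coboundary operator on the `c^a` in Euclidean signature. -/
noncomputable def euclideanGhCoeff (N : ℕ) : Fin 4 → SusyPoly N :=
  ![quadric N 1 1 - quadric N 0 0, const Complex.I * (quadric N 0 0 + quadric N 1 1),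
    quadric N 0 1 + quadric N 1 0, const Complex.I * (quadric N 1 0 - quadric N 0 1)]

theorem quadForm_euclideanGamma (a : Fin 4) :
    quadForm N ((Complex.I / 2) • (euclideanGamma a * (standardRep t).conj⁻¹)) =
      euclideanGhCoeff N a := by
  have h1 : (2 * C (Complex.I / 2) : SusyPoly N) = const Complex.I := by
    rw [two_mul, ← C_add, add_halves]
  have h2 : (2 * (C (Complex.I / 2) * C Complex.I) : SusyPoly N) = -1 := by
    rw [← mul_assoc, h1, const_I_mul_const_I]
  rw [standardRep_conj_inv]
  fin_cases a <;>
    simp [quadForm, euclideanGamma, euclideanGhCoeff, quadric, posIdx, negIdx,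
      Fin.sum_univ_four, xi, ← Finset.sum_add_distrib, ← Finset.sum_sub_distrib, Finset.mul_sum,
      -map_div₀]
  · refine Finset.sum_congr rfl fun i _ => ?_
    linear_combination (X (i, 0) * X (i, 1) - X (i, 2) * X (i, 3)) * h2
  · refine Finset.sum_congr rfl fun i _ => ?_
    linear_combination (X (i, 0) * X (i, 1) + X (i, 2) * X (i, 3)) * h1
  · refine Finset.sum_congr rfl fun i _ => ?_
    linear_combination -(X (i, 0) * X (i, 2) + X (i, 1) * X (i, 3)) * h2
  · refine Finset.sum_congr rfl fun i _ => ?_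
    linear_combination (X (i, 1) * X (i, 3) - X (i, 0) * X (i, 2)) * h1

theorem ghCoeff_standardRep (a : Fin 4) :
    ghCoeff t (standardRep t) N a =
      const (metricSign t a * kFactor t a) * euclideanGhCoeff N a := by
  rw [← quadForm_euclideanGamma t, ← quadForm_smul, ghCoeff, standardRep_gamma]
  congr 1
  simp only [Matrix.smul_mul, smul_smul]
  congr 1
  ring

theorem ghVtheta_standardRep (i : Fin N) (α : Fin 4) :
    ghVtheta t (standardRep t) i α =
      ∑ a, (∑ β, const (euclideanGamma a β α) * xi i β) * euclideanGhCoeff N a := by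
  refine Finset.sum_congr rfl fun a _ => ?_
  have h1 : (const (metricSign t a * kFactor t a) * const (kFactor t a) : SusyPoly N) = 1 := by
    rw [const, ← map_mul, metricSign_mul_kFactor_mul_kFactor, map_one]
  have h2 : ∑ β, const ((standardRep t).gamma a β α) * xi i β =
      const (kFactor t a) * ∑ β, const (euclideanGamma a β α) * xi i β := by
    rw [standardRep_gamma, Finset.mul_sum]
    refine Finset.sum_congr rfl fun β _ => ?_
    rw [Matrix.smul_apply, smul_eq_mul, const, map_mul, mul_assoc]
  rw [h2, ghCoeff_standardRep]
  linear_combination ((∑ β, const (euclideanGamma a β α) * xi i β) * euclideanGhCoeff N a) * h1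

theorem ghVtheta_standardRep_eq (i : Fin N) :
    ghVtheta t (standardRep t) i =
      ![2 * (xi i 1 * quadric N 0 1 - xi i 2 * quadric N 0 0),
        2 * (xi i 0 * quadric N 1 0 - xi i 3 * quadric N 0 0),
        2 * (xi i 0 * quadric N 1 1 - xi i 3 * quadric N 0 1),
        2 * (xi i 1 * quadric N 1 1 - xi i 2 * quadric N 1 0)] := by
  have hI := const_I_mul_const_I (N := N)
  funext α
  rw [ghVtheta_standardRep]
  fin_cases α <;> simp [euclideanGamma, euclideanGhCoeff, Fin.sum_univ_four]
  · linear_combination (xi i 2 * (quadric N 0 0 + quadric N 1 1) +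
      xi i 1 * (quadric N 1 0 - quadric N 0 1)) * hI
  · linear_combination (xi i 3 * (quadric N 0 0 + quadric N 1 1) -
      xi i 0 * (quadric N 1 0 - quadric N 0 1)) * hI
  · linear_combination (-xi i 0 * (quadric N 0 0 + quadric N 1 1) -
      xi i 3 * (quadric N 1 0 - quadric N 0 1)) * hI
  · linear_combination (-xi i 1 * (quadric N 0 0 + quadric N 1 1) +
      xi i 2 * (quadric N 1 0 - quadric N 0 1)) * hI

theorem ghVthetaPlus_standardRep (i : Fin N) (α : Fin 4) :
    ghVthetaPlus t (standardRep t) i α = const (2 * Complex.I) * ∑ j,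
      spinorDot (standardRep t) (xiMinus (standardRep t) i) (xiMinus (standardRep t) j) *
        xiPlus (standardRep t) j α := by
  have hI := const_I_mul_const_I (N := N)
  have h2 : (const (2 * Complex.I) : SusyPoly N) = 2 * const Complex.I := by
    rw [const, map_mul]; rfl
  rw [ghVthetaPlus, standardRep_projPlus, ghVtheta_standardRep_eq, h2]
  simp only [spinorDot_standardRep, xiPlus_standardRep, xiMinus_standardRep]
  fin_cases α <;>
    simp [Fin.sum_univ_four, quadric, posIdx, negIdx, Finset.mul_sum, xi,
      ← Finset.sum_sub_distrib]
  · refine Finset.sum_congr rfl fun j _ => ?_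
    linear_combination -2 * ((X (i, 2) * X (j, 1) - X (i, 1) * X (j, 2)) * X (j, 0)) * hI
  · refine Finset.sum_congr rfl fun j _ => ?_
    linear_combination -2 * ((X (i, 2) * X (j, 1) - X (i, 1) * X (j, 2)) * X (j, 3)) * hI

theorem ghVthetaMinus_standardRep (i : Fin N) (α : Fin 4) :
    ghVthetaMinus t (standardRep t) i α = const (2 * Complex.I) * ∑ j,
      spinorDot (standardRep t) (xiPlus (standardRep t) i) (xiPlus (standardRep t) j) *
        xiMinus (standardRep t) j α := by
  have hI := const_I_mul_const_I (N := N)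
  have h2 : (const (2 * Complex.I) : SusyPoly N) = 2 * const Complex.I := by
    rw [const, map_mul]; rfl
  rw [ghVthetaMinus, standardRep_projMinus, ghVtheta_standardRep_eq, h2]
  simp only [spinorDot_standardRep, xiPlus_standardRep, xiMinus_standardRep]
  fin_cases α <;>
    simp [Fin.sum_univ_four, quadric, posIdx, negIdx, Finset.mul_sum, xi,
      ← Finset.sum_sub_distrib]
  · refine Finset.sum_congr rfl fun j _ => ?_
    linear_combination -2 * ((X (i, 3) * X (j, 0) - X (i, 0) * X (j, 3)) * X (j, 1)) * hI
  · refine Finset.sum_congr rfl fun j _ => ?_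
    linear_combination -2 * ((X (i, 3) * X (j, 0) - X (i, 0) * X (j, 3)) * X (j, 2)) * hI

end Standard

/-! ### The explicit form of the coboundaries -/


section Explicit

variable {N : ℕ} {t : ℕ} {ρ : SpinorRep} {S : Matrix (Fin 4) (Fin 4) ℂ}

theorem ChangesBy.spinorMul_equiv_sum {ρ₀ : SpinorRep} (h : ChangesBy S ρ₀ ρ) (z : ℂ)
    (c : Fin N → SusyPoly N) (v : Fin N → Fin 4 → SusyPoly N) (α : Fin 4) :
    spinorMul S (fun γ => spinorEquiv N S h.isUnit (const z * ∑ j, c j * v j γ)) α =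
      const z * ∑ j, spinorEquiv N S h.isUnit (c j) *
        spinorMul S (fun γ => spinorEquiv N S h.isUnit (v j γ)) α := by
  have h2 : spinorEquiv N S h.isUnit (const z) = const z := spinorSubst_const _ z
  simp only [spinorMul, map_mul, map_sum, h2, Finset.mul_sum]
  rw [Finset.sum_comm]
  exact Finset.sum_congr rfl fun j _ => Finset.sum_congr rfl fun γ _ => by ring

/-- The Fierz identity for `ϑ_i^+`. -/
theorem ghVthetaPlus_eq (h : ChangesBy S (standardRep t) ρ) (i : Fin N) (α : Fin 4) :
    ghVthetaPlus t ρ i α = const (2 * Complex.I) *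
      ∑ j, spinorDot ρ (xiMinus ρ i) (xiMinus ρ j) * xiPlus ρ j α := by
  rw [h.ghVthetaPlus]
  simp only [ghVthetaPlus_standardRep]
  rw [h.spinorMul_equiv_sum]
  refine congrArg _ (Finset.sum_congr rfl fun j _ => ?_)
  rw [h.xiPlus, h.xiMinus, h.xiMinus, h.spinorDot]

/-- The Fierz identity for `ϑ_i^-`. -/
theorem ghVthetaMinus_eq (h : ChangesBy S (standardRep t) ρ) (i : Fin N) (α : Fin 4) :
    ghVthetaMinus t ρ i α = const (2 * Complex.I) *
      ∑ j, spinorDot ρ (xiPlus ρ i) (xiPlus ρ j) * xiMinus ρ j α := by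
  rw [h.ghVthetaMinus]
  simp only [ghVthetaMinus_standardRep]
  rw [h.spinorMul_equiv_sum]
  refine congrArg _ (Finset.sum_congr rfl fun j _ => ?_)
  rw [h.xiMinus, h.xiPlus, h.xiPlus, h.spinorDot]

theorem conj_inv_antisymm (h : ChangesBy S (standardRep t) ρ) (α β : Fin 4) :
    ρ.conj⁻¹ α β = -ρ.conj⁻¹ β α := by
  have h0 : ((standardRep t).conj⁻¹).transpose = -(standardRep t).conj⁻¹ := by
    rw [standardRep_conj_inv]
    ext i j
    fin_cases i <;> fin_cases j <;> simp
  have h1 : (ρ.conj⁻¹).transpose = -ρ.conj⁻¹ := by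
    rw [h.conj_inv, Matrix.transpose_mul, Matrix.transpose_mul, h0, Matrix.transpose_transpose]
    simp [mul_assoc]
  have h2 := congrFun (congrFun h1 β) α
  simpa using h2

theorem spinorDot_antisymm (h : ChangesBy S (standardRep t) ρ) (u v : Fin 4 → SusyPoly N) :
    spinorDot ρ u v = -spinorDot ρ v u := by
  unfold spinorDot
  rw [Finset.sum_comm, ← Finset.sum_neg_distrib]
  refine Finset.sum_congr rfl fun α _ => ?_
  rw [← Finset.sum_neg_distrib]
  refine Finset.sum_congr rfl fun β _ => ?_
  rw [conj_inv_antisymm h β α, const, map_neg]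
  ring

theorem spinorDot_self (h : ChangesBy S (standardRep t) ρ) (u : Fin 4 → SusyPoly N) :
    spinorDot ρ u u = 0 :=
  self_eq_neg.1 (spinorDot_antisymm h u u)

theorem spinorDot_const_mul_sum (z : ℂ) (c : Fin N → SusyPoly N) (v : Fin N → Fin 4 → SusyPoly N)
    (u : Fin 4 → SusyPoly N) :
    spinorDot ρ (fun α => const z * ∑ j, c j * v j α) u =
      const z * ∑ j, c j * spinorDot ρ (v j) u := by
  simp only [spinorDot, Finset.mul_sum, Finset.sum_mul]
  rw [Finset.sum_comm_cycle]
  refine Finset.sum_congr rfl fun j _ => Finset.sum_congr rfl fun α _ =>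
    Finset.sum_congr rfl fun β _ => by ring

theorem spinorDot_ghVthetaPlus (h : ChangesBy S (standardRep t) ρ) (i : Fin N) :
    spinorDot ρ (ghVthetaPlus t ρ i) (xiPlus ρ i) = const (2 * Complex.I) *
      ∑ j, spinorDot ρ (xiMinus ρ i) (xiMinus ρ j) * spinorDot ρ (xiPlus ρ j) (xiPlus ρ i) := by
  rw [← spinorDot_const_mul_sum]
  congr 1
  funext α
  exact ghVthetaPlus_eq h i α

/-- The Fierz identities give the coboundaries; the terms with `i = 1` or `j = 1` in the coefficient
of `B` cancel by the antisymmetry of the product of spinors. -/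
theorem gh_primitiveOf_eq [NeZero N] (h : ChangesBy S (standardRep t) ρ) (B : SusyPoly N)
    (P Q : Fin 4 → SusyPoly N) :
    gh t ρ (primitiveOf ρ B P Q) = ofSusy (explicitCoboundary ρ B P Q) := by
  rw [gh_primitiveOf]
  refine congrArg ofSusy ?_
  set s := Finset.univ.erase (0 : Fin N) with hs
  have hsplit (f : Fin N → SusyPoly N) : ∑ j, f j = f 0 + ∑ j ∈ s, f j :=
    (Finset.add_sum_erase _ _ (Finset.mem_univ _)).symm
  have hP (α : Fin 4) : ghVthetaPlus t ρ 0 α = const (2 * Complex.I) *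
      ∑ j ∈ s, spinorDot ρ (xiMinus ρ 0) (xiMinus ρ j) * xiPlus ρ j α := by
    rw [ghVthetaPlus_eq h, hsplit, spinorDot_self h, zero_mul, zero_add]
  have hQ (α : Fin 4) : ghVthetaMinus t ρ 0 α = const (2 * Complex.I) *
      ∑ j ∈ s, spinorDot ρ (xiPlus ρ 0) (xiPlus ρ j) * xiMinus ρ j α := by
    rw [ghVthetaMinus_eq h, hsplit, spinorDot_self h, zero_mul, zero_add]
  have hPs : ∑ α, P α * ghVthetaPlus t ρ 0 α = const (2 * Complex.I) *
      ∑ j ∈ s, spinorDot ρ (xiMinus ρ 0) (xiMinus ρ j) * ∑ α, xiPlus ρ j α * P α := by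
    simp only [hP, Finset.mul_sum]
    rw [Finset.sum_comm]
    exact Finset.sum_congr rfl fun j _ => Finset.sum_congr rfl fun α _ => by ring
  have hQs : ∑ α, Q α * ghVthetaMinus t ρ 0 α = const (2 * Complex.I) *
      ∑ j ∈ s, spinorDot ρ (xiPlus ρ 0) (xiPlus ρ j) * ∑ α, xiMinus ρ j α * Q α := by
    simp only [hQ, Finset.mul_sum]
    rw [Finset.sum_comm]
    exact Finset.sum_congr rfl fun j _ => Finset.sum_congr rfl fun α _ => by ring
  have hB : spinorDot ρ (ghVthetaPlus t ρ 0) (xiPlus ρ 0) -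
      ∑ i ∈ s, spinorDot ρ (ghVthetaPlus t ρ i) (xiPlus ρ i) = const (2 * Complex.I) *
        ∑ i ∈ s, ∑ j ∈ s, spinorDot ρ (xiPlus ρ i) (xiPlus ρ j) *
          spinorDot ρ (xiMinus ρ i) (xiMinus ρ j) := by
    simp only [spinorDot_ghVthetaPlus h, ← Finset.mul_sum, ← mul_sub]
    congr 1
    rw [hsplit, spinorDot_self h, zero_mul, zero_add, ← Finset.sum_sub_distrib]
    refine Finset.sum_congr rfl fun i _ => ?_
    rw [hsplit, spinorDot_antisymm h (xiMinus ρ i) (xiMinus ρ 0),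
      spinorDot_antisymm h (xiPlus ρ i) (xiPlus ρ 0)]
    have h1 : ∑ j ∈ s, spinorDot ρ (xiPlus ρ i) (xiPlus ρ j) *
        spinorDot ρ (xiMinus ρ i) (xiMinus ρ j) = -∑ j ∈ s,
        spinorDot ρ (xiMinus ρ i) (xiMinus ρ j) * spinorDot ρ (xiPlus ρ j) (xiPlus ρ i) := by
      rw [← Finset.sum_neg_distrib]
      refine Finset.sum_congr rfl fun j _ => ?_
      rw [spinorDot_antisymm h (xiPlus ρ i) (xiPlus ρ j)]
      ring
    rw [h1]
    ring
  rw [hB, hPs, hQs, explicitCoboundary, Finset.sum_add_distrib]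
  ring

end Explicit

/-! ### The ideal of coboundaries of degree zero -/

section Ideal

open MvPolynomial

variable {N : ℕ} {t : ℕ} {ρ : SpinorRep} {S : Matrix (Fin 4) (Fin 4) ℂ}

/-- The combinations of the Euclidean `c^a` whose coboundaries are the four quadrics. -/
noncomputable def quadricMatrix : Matrix (Fin 4) (Fin 4) ℂ :=
  !![-(1 / 2), 0, 0, 1 / 2; -(Complex.I / 2), 0, 0, -(Complex.I / 2); 0, 1 / 2, 1 / 2, 0;
    0, Complex.I / 2, -(Complex.I / 2), 0]

/-- The inverse of `quadricMatrix`. -/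
noncomputable def quadricMatrixInv : Matrix (Fin 4) (Fin 4) ℂ :=
  !![-1, Complex.I, 0, 0; 0, 0, 1, -Complex.I; 0, 0, 1, Complex.I; 1, Complex.I, 0, 0]

theorem quadricMatrixInv_mul : quadricMatrixInv * quadricMatrix = 1 := by
  have hI : Complex.I * (Complex.I / 2) = -(1 / 2) := by
    rw [← mul_div_assoc, Complex.I_mul_I]; ring
  ext i j
  fin_cases i <;> fin_cases j <;>
    simp [quadricMatrix, quadricMatrixInv, Matrix.mul_apply, Fin.sum_univ_four, hI] <;> norm_num

/-- `quadricMatrix` in arbitrary signature. -/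
noncomputable def signedQuadricMatrix (t : ℕ) : Matrix (Fin 4) (Fin 4) ℂ :=
  Matrix.diagonal (kFactor t) * quadricMatrix

theorem isUnit_det_signedQuadricMatrix (t : ℕ) : IsUnit (signedQuadricMatrix t).det := by
  refine Matrix.isUnit_det_of_left_inverse
    (B := quadricMatrixInv * Matrix.diagonal fun a => metricSign t a * kFactor t a) ?_
  rw [signedQuadricMatrix, mul_assoc, ← mul_assoc (Matrix.diagonal _), Matrix.diagonal_mul_diagonal]
  simp only [metricSign_mul_kFactor_mul_kFactor]
  rw [Matrix.diagonal_one, one_mul, quadricMatrixInv_mul]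

/-- A basis of the translation ghosts whose coboundaries are the four quadrics. -/
noncomputable def quadricBasis (t N : ℕ) :
    Module.Basis (Fin 4) (SusyPoly N) (Fin 4 → SusyPoly N) :=
  (Pi.basisFun (SusyPoly N) (Fin 4)).map
    (Matrix.toLin'OfInv (M := (signedQuadricMatrix t)⁻¹.map C) (M' := (signedQuadricMatrix t).map C)
      (by rw [← Matrix.map_mul, Matrix.nonsing_inv_mul _ (isUnit_det_signedQuadricMatrix t),
            Matrix.map_one _ C_0 C_1])
      (by rw [← Matrix.map_mul, Matrix.mul_nonsing_inv _ (isUnit_det_signedQuadricMatrix t),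
            Matrix.map_one _ C_0 C_1]))

theorem quadricBasis_apply (b a : Fin 4) :
    quadricBasis t N b a = const (kFactor t a * quadricMatrix a b) := by
  simp [quadricBasis, Matrix.toLin'OfInv, signedQuadricMatrix,
    Matrix.mulVec_diagonal]

theorem sum_euclideanGhCoeff_mul (b : Fin 4) :
    ∑ a, euclideanGhCoeff N a * const (quadricMatrix a b) = quadricSeq N b := by
  have h1 : (C 2⁻¹ + C 2⁻¹ : SusyPoly N) = 1 := by
    rw [← C_add, ← C_1]; norm_num
  have h2 : (C (Complex.I / 2) * C Complex.I : SusyPoly N) = -C 2⁻¹ := by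
    rw [← C_mul, ← C_neg, div_mul_eq_mul_div, Complex.I_mul_I]; norm_num
  fin_cases b <;>
    simp [quadricMatrix, euclideanGhCoeff, quadricSeq, Fin.sum_univ_four, -map_div₀]
  · linear_combination quadric N 0 0 * h1 - (quadric N 0 0 + quadric N 1 1) * h2
  · linear_combination quadric N 0 1 * h1 + (quadric N 1 0 - quadric N 0 1) * h2
  · linear_combination quadric N 1 0 * h1 - (quadric N 1 0 - quadric N 0 1) * h2
  · linear_combination quadric N 1 1 * h1 - (quadric N 0 0 + quadric N 1 1) * h2

theorem ghDual_quadricBasis (h : ChangesBy S (standardRep t) ρ) (b : Fin 4) :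
    ghDual t ρ N (quadricBasis t N b) = spinorEquiv N S h.isUnit (quadricSeq N b) := by
  have h2 (z : ℂ) : spinorEquiv N S h.isUnit (const z) = const z := spinorSubst_const _ z
  rw [← sum_euclideanGhCoeff_mul, map_sum, ghDual, LinearMap.sum_apply]
  refine Finset.sum_congr rfl fun a _ => ?_
  have h1 : (const (metricSign t a * kFactor t a) * const (kFactor t a) : SusyPoly N) = 1 := by
    rw [const, ← map_mul, metricSign_mul_kFactor_mul_kFactor, map_one]
  have h3 : (const (kFactor t a * quadricMatrix a b) : SusyPoly N) =
      const (kFactor t a) * const (quadricMatrix a b) := map_mul _ _ _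
  rw [LinearMap.smul_apply, LinearMap.proj_apply, quadricBasis_apply, h.ghCoeff,
    ghCoeff_standardRep, map_mul, map_mul, h2, h2, h3, smul_eq_mul]
  linear_combination (spinorEquiv N S h.isUnit (euclideanGhCoeff N a) *
    const (quadricMatrix a b)) * h1

theorem WeaklyRegular.map_equiv {A B : Type*} [CommRing A] [CommRing B] (φ : A ≃+* B) {n : ℕ}
    {p : Fin n → A} (hp : WeaklyRegular p) : WeaklyRegular fun j => φ (p j) := by
  have hI (k : ℕ) (r : B) :
      r ∈ initialIdeal (fun j => φ (p j)) k ↔ φ.symm r ∈ initialIdeal p k := by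
    have h1 : initialIdeal (fun j => φ (p j)) k = (initialIdeal p k).map φ := by
      unfold initialIdeal
      rw [Ideal.map_span, Set.image_image]
    rw [h1]
    refine (Ideal.mem_map_of_equiv φ r).trans ?_
    constructor
    · rintro ⟨x, hx, rfl⟩
      simpa using hx
    · intro h
      exact ⟨_, h, by simp⟩
  intro k r h
  rw [hI] at h ⊢
  exact hp k _ (by simpa using h)

theorem weaklyRegular_ghDual (h : ChangesBy S (standardRep t) ρ) (hN : 2 < N) :
    WeaklyRegular fun b => ghDual t ρ N (quadricBasis t N b) := by
  simp only [ghDual_quadricBasis h]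
  exact (weaklyRegular_quadricSeq hN).map_equiv (spinorEquiv N S h.isUnit).toRingEquiv

/-- The scalars among the coboundaries are, in adapted coordinates, the combinations of the four
quadrics. -/
theorem exists_gh_eq_ofSusy_iff (h : ChangesBy S (standardRep t) ρ) (r : SusyPoly N) :
    (∃ η, gh t ρ η = ofSusy r) ↔ ∃ c : Fin 2 → Fin 2 → SusyPoly N,
      (spinorEquiv N S h.isUnit).symm r = ∑ α, ∑ β, c α β * quadric N α β := by
  rw [gh_eq_contr, exists_contr_eq_algebraMap_iff (quadricBasis t N) (ghDual t ρ N)]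
  simp only [ghDual_quadricBasis h]
  rw [Ideal.mem_span_range_iff_exists_fun]
  constructor
  · rintro ⟨c, rfl⟩
    refine ⟨fun α β => (spinorEquiv N S h.isUnit).symm (![![c 0, c 1], ![c 2, c 3]] α β), ?_⟩
    simp [Fin.sum_univ_four, Fin.sum_univ_two, quadricSeq]
    ring
  · rintro ⟨c, hc⟩
    refine ⟨fun j => spinorEquiv N S h.isUnit (![c 0 0, c 0 1, c 1 0, c 1 1] j), ?_⟩
    rw [← (spinorEquiv N S h.isUnit).apply_symm_apply r, hc]
    simp [Fin.sum_univ_four, Fin.sum_univ_two, quadricSeq]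
    ring

end Ideal

/-! ### The subalgebras of polynomials in adapted coordinates -/


section Subalgebras

open MvPolynomial

variable {N : ℕ} [NeZero N] {t : ℕ} {ρ : SpinorRep} {S : Matrix (Fin 4) (Fin 4) ℂ}

/-- The variables `ξ_1^{+α}` in the standard representation. -/
def posBlock (N : ℕ) [NeZero N] (a : Fin 2) : Fin N × Fin 4 := (0, posIdx a)

/-- The variables `ξ_1^{-α}` in the standard representation. -/
def negBlock (N : ℕ) [NeZero N] (a : Fin 2) : Fin N × Fin 4 := (0, negIdx a)

/-- The part of the quadrics that does not involve `ξ_1`. -/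
noncomputable def quadricRest (N : ℕ) [NeZero N] (a b : Fin 2) : SusyPoly N :=
  ∑ i ∈ Finset.univ.erase (0 : Fin N), X (i, posIdx a) * X (i, negIdx b)

theorem relator_eq_quadric (a b : Fin 2) :
    relator (posBlock N) (negBlock N) (quadricRest N) a b = quadric N a b :=
  Finset.add_sum_erase Finset.univ (fun i : Fin N => X (i, posIdx a) * X (i, negIdx b))
    (Finset.mem_univ 0)

theorem X_mem_freeOf {blk : Fin 2 → Fin 4} {i : Fin N} {γ : Fin 4}
    (h : i ≠ 0 ∨ ∀ a, blk a ≠ γ) :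
    (X (i, γ) : SusyPoly N) ∈ freeOf ℂ (fun a => ((0 : Fin N), blk a)) := by
  refine killBlock_X_of_notMem fun a hne => ?_
  rw [Prod.mk.injEq] at hne
  rcases h with h | h
  · exact h hne.1.symm
  · exact h a hne.2

theorem blocks_quadricRest : Blocks (posBlock N) (negBlock N) (quadricRest N) where
  injective_left a b h := by
    have h := (Prod.mk.inj h).2
    fin_cases a <;> fin_cases b <;> simp_all [posIdx]
  injective_right a b h := by
    have h := (Prod.mk.inj h).2
    fin_cases a <;> fin_cases b <;> simp_all [negIdx]
  disjoint a b h := by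
    have h := (Prod.mk.inj h).2
    fin_cases a <;> fin_cases b <;> simp_all [posIdx, negIdx]
  mem_left a b := sum_mem fun i hi =>
    mul_mem (X_mem_freeOf (Or.inl (Finset.ne_of_mem_erase hi)))
      (X_mem_freeOf (Or.inl (Finset.ne_of_mem_erase hi)))
  mem_right a b := sum_mem fun i hi =>
    mul_mem (X_mem_freeOf (Or.inl (Finset.ne_of_mem_erase hi)))
      (X_mem_freeOf (Or.inl (Finset.ne_of_mem_erase hi)))

/-- The polynomials in `ξ_2, …, ξ_N` and the components of one chirality of `ξ_1` correspond to
those that are free of the components of the opposite chirality in the standard coordinates. Here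
`v` is the projection of `ξ_1` to the first chirality in the standard representation. -/
theorem mem_adjoin_iff (hS : IsUnit S.det) {blk : Fin 2 → Fin 4} {v : Fin 4 → SusyPoly N}
    (hv : ∀ γ, v γ = if ∃ a, blk a = γ then 0 else xi 0 γ) (p : SusyPoly N) :
    p ∈ Algebra.adjoin ℂ
        ({x | ∃ α, x = spinorMul S (fun γ => spinorEquiv N S hS (v γ)) α} ∪
          {x | ∃ i : Fin N, i ≠ 0 ∧ ∃ α, x = xi i α}) ↔
      (spinorEquiv N S hS).symm p ∈ freeOf ℂ (fun a => ((0 : Fin N), blk a)) := by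
  set ψ := spinorEquiv N S hS with hψ
  set A := Algebra.adjoin ℂ
    ({x | ∃ α, x = spinorMul S (fun γ => ψ (v γ)) α} ∪
      {x | ∃ i : Fin N, i ≠ 0 ∧ ∃ α, x = xi i α}) with hA
  have hxi (i : Fin N) (hi : i ≠ 0) (α : Fin 4) : xi i α ∈ A :=
    Algebra.subset_adjoin (Or.inr ⟨i, hi, α, rfl⟩)
  have hvA (γ : Fin 4) : ψ (v γ) ∈ A := by
    have h1 : spinorMul S⁻¹ (spinorMul S fun γ => ψ (v γ)) = fun γ => ψ (v γ) := by
      rw [spinorMul_spinorMul, Matrix.mul_nonsing_inv _ hS, spinorMul_one]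
    have h2 := spinorMul_mem S⁻¹ (A := A) (u := spinorMul S fun γ => ψ (v γ))
      (fun α => Algebra.subset_adjoin (Or.inl ⟨α, rfl⟩)) γ
    rwa [h1] at h2
  constructor
  · intro hp
    refine Algebra.adjoin_induction (p := fun x _ => ψ.symm x ∈ freeOf ℂ _) ?_ (fun z => ?_)
      (fun x y _ _ hx hy => ?_) (fun x y _ _ hx hy => ?_) hp
    · rintro x (⟨α, rfl⟩ | ⟨i, hi, α, rfl⟩)
      · have h1 : ψ.symm (spinorMul S (fun γ => ψ (v γ)) α) = spinorMul S v α := by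
          refine (spinorSubst_spinorMul S S (fun γ => ψ (v γ)) α).trans ?_
          congr 1
          funext γ
          exact ψ.symm_apply_apply (v γ)
        rw [h1]
        refine spinorMul_mem S (fun γ => ?_) α
        rw [hv]
        split_ifs with hγ
        · exact zero_mem _
        · exact X_mem_freeOf (Or.inr (not_exists.1 hγ))
      · have h1 : ψ.symm (xi i α) = spinorMul S (xi i) α := spinorSubst_xi_eq_spinorMul S i α
        rw [h1]
        exact spinorMul_mem S (fun γ => X_mem_freeOf (Or.inl hi)) α
    · rw [AlgEquiv.commutes]
      exact (freeOf ℂ _).algebraMap_mem z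
    · rw [map_add]
      exact add_mem hx hy
    · rw [map_mul]
      exact mul_mem hx hy
  · intro hp
    have hkill (q : SusyPoly N) : ψ (killBlock (fun a => ((0 : Fin N), blk a)) q) ∈ A := by
      induction q using MvPolynomial.induction_on with
      | C z =>
        rw [← MvPolynomial.algebraMap_eq, AlgHom.commutes, AlgEquiv.commutes]
        exact A.algebraMap_mem z
      | add p q hp hq => rw [map_add, map_add]; exact add_mem hp hq
      | mul_X p j hp =>
        obtain ⟨i, γ⟩ := j
        rw [map_mul, map_mul]
        refine mul_mem hp ?_
        by_cases hi : i = 0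
        · subst hi
          by_cases hγ : ∃ a, blk a = γ
          · obtain ⟨a, rfl⟩ := hγ
            rw [killBlock_X_mem (fun a => ((0 : Fin N), blk a)) a, map_zero]
            exact zero_mem _
          · rw [mem_freeOf.1 (X_mem_freeOf (Or.inr (not_exists.1 hγ)))]
            have := hvA γ
            rwa [hv, if_neg hγ] at this
        · rw [mem_freeOf.1 (X_mem_freeOf (Or.inl hi))]
          change ψ (xi i γ) ∈ A
          rw [hψ, spinorEquiv_apply, spinorSubst_xi_eq_spinorMul]
          exact spinorMul_mem S⁻¹ (hxi i hi) γ
    have := hkill (ψ.symm p)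
    rwa [mem_freeOf.1 hp, AlgEquiv.apply_symm_apply] at this

theorem mem_polyMinus_iff (h : ChangesBy S (standardRep t) ρ) (p : SusyPoly N) :
    p ∈ polyMinus ρ N ↔ (spinorEquiv N S h.isUnit).symm p ∈ freeOf ℂ (posBlock N) := by
  rw [polyMinus, h.xiMinus]
  refine mem_adjoin_iff (blk := posIdx) h.isUnit (fun γ => ?_) p
  rw [xiMinus_standardRep]
  fin_cases γ <;> simp [posIdx, Fin.exists_fin_two]

theorem mem_polyPlus_iff (h : ChangesBy S (standardRep t) ρ) (p : SusyPoly N) :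
    p ∈ polyPlus ρ N ↔ (spinorEquiv N S h.isUnit).symm p ∈ freeOf ℂ (negBlock N) := by
  rw [polyPlus, h.xiPlus]
  refine mem_adjoin_iff (blk := negIdx) h.isUnit (fun γ => ?_) p
  rw [xiPlus_standardRep]
  fin_cases γ <;> simp [negIdx, Fin.exists_fin_two]

theorem spinorEquiv_mem_polyRest (hS : IsUnit S.det) {q : SusyPoly N}
    (hq : q ∈ freeOf ℂ (posBlock N) ⊓ freeOf ℂ (negBlock N)) :
    spinorEquiv N S hS q ∈ polyRest N := by
  have hkill (q : SusyPoly N) : spinorEquiv N S hS (killBlock (posBlock N)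
      (killBlock (negBlock N) q)) ∈ polyRest N := by
    induction q using MvPolynomial.induction_on with
    | C z =>
      rw [← MvPolynomial.algebraMap_eq, AlgHom.commutes, AlgHom.commutes, AlgEquiv.commutes]
      exact (polyRest N).algebraMap_mem z
    | add p q hp hq => simp only [map_add]; exact add_mem hp hq
    | mul_X p j hp =>
      obtain ⟨i, γ⟩ := j
      simp only [map_mul]
      refine mul_mem hp ?_
      by_cases hi : i = 0
      · subst hi
        have hγ : (∃ a, posBlock N a = (0, γ)) ∨ ∃ b, negBlock N b = (0, γ) := by
          fin_cases γ <;> simp [posBlock, negBlock, posIdx, negIdx, Fin.exists_fin_two]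
        rcases hγ with ⟨a, ha⟩ | ⟨b, hb⟩
        · rw [killBlock_comm, ← ha, killBlock_X_mem, map_zero, map_zero]
          exact zero_mem _
        · rw [← hb, killBlock_X_mem, map_zero, map_zero]
          exact zero_mem _
      · have h1 : killBlock (negBlock N) (X (i, γ) : SusyPoly N) = X (i, γ) :=
          X_mem_freeOf (blk := negIdx) (Or.inl hi)
        have h2 : killBlock (posBlock N) (X (i, γ) : SusyPoly N) = X (i, γ) :=
          X_mem_freeOf (blk := posIdx) (Or.inl hi)
        rw [h1, h2]
        change spinorEquiv N S hS (xi i γ) ∈ _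
        rw [spinorEquiv_apply, spinorSubst_xi_eq_spinorMul]
        exact spinorMul_mem S⁻¹ (A := polyRest N)
          (fun β => Algebra.subset_adjoin (Set.mem_ofPred_eq ▸ ⟨i, hi, β, rfl⟩)) γ
  have := hkill q
  rwa [mem_freeOf.1 hq.2, mem_freeOf.1 hq.1] at this

end Subalgebras

/-! ### Coboundaries in adapted coordinates -/

section ExplicitStandard

open MvPolynomial

variable {N : ℕ} [NeZero N] {t : ℕ} {ρ : SpinorRep} {S : Matrix (Fin 4) (Fin 4) ℂ}

theorem explicitCoboundary_equiv (h : ChangesBy S (standardRep t) ρ) (B : SusyPoly N)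
    (P Q : Fin 4 → SusyPoly N) :
    explicitCoboundary ρ (spinorEquiv N S h.isUnit B)
        (spinorMul S⁻¹.transpose fun γ => spinorEquiv N S h.isUnit (P γ))
        (spinorMul S⁻¹.transpose fun γ => spinorEquiv N S h.isUnit (Q γ)) =
      spinorEquiv N S h.isUnit (explicitCoboundary (standardRep t) B P Q) := by
  have h2 (z : ℂ) : spinorEquiv N S h.isUnit (const z) = const z := spinorSubst_const _ z
  simp only [explicitCoboundary, h.xiPlus, h.xiMinus, h.spinorDot,
    sum_spinorMul_mul_spinorMul_inv h.isUnit, map_add, map_mul, map_sum, h2]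

theorem sum_sum_mul_eq_two_mul_det {κ A : Type*} [CommRing A] (s : Finset κ) (x y u v : κ → A) :
    ∑ i ∈ s, ∑ j ∈ s, (y i * x j - x i * y j) * (v i * u j - u i * v j) =
      2 * ((∑ i ∈ s, x i * u i) * (∑ i ∈ s, y i * v i) -
        (∑ i ∈ s, x i * v i) * ∑ i ∈ s, y i * u i) := by
  have h1 : ∑ i ∈ s, ∑ j ∈ s, (y i * x j - x i * y j) * (v i * u j - u i * v j) =
      (∑ i ∈ s, y i * v i) * (∑ i ∈ s, x i * u i) - (∑ i ∈ s, y i * u i) * (∑ i ∈ s, x i * v i) -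
      (∑ i ∈ s, x i * v i) * (∑ i ∈ s, y i * u i) +
      (∑ i ∈ s, x i * u i) * (∑ i ∈ s, y i * v i) := by
    simp only [Finset.sum_mul_sum, ← Finset.sum_add_distrib, ← Finset.sum_sub_distrib]
    exact Finset.sum_congr rfl fun i _ => Finset.sum_congr rfl fun j _ => by ring
  rw [h1]
  ring

/-- In the standard representation the explicit coboundaries are the combinations of minors. -/
theorem explicitCoboundary_standardRep (B : SusyPoly N) (P Q : Fin 2 → SusyPoly N) :
    explicitCoboundary (standardRep t) (const (Complex.I / 4) * B)
        ![const (-(1 / 2)) * P 0, 0, 0, const (-(1 / 2)) * P 1]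
        ![0, const (-(1 / 2)) * Q 0, const (-(1 / 2)) * Q 1, 0] =
      blockDet (quadricRest N) * B +
        ∑ α, blockMinor (negBlock N) (fun α β => quadricRest N β α) α * P α +
        ∑ β, blockMinor (posBlock N) (quadricRest N) β * Q β := by
  set s := Finset.univ.erase (0 : Fin N) with hs
  have hI := const_I_mul_const_I (N := N)
  have hB : (const (2 * Complex.I) * const (Complex.I / 4) * 2 : SusyPoly N) = -1 := by
    have h2 : (2 : SusyPoly N) = const 2 := rfl
    have h3 : (2 * Complex.I * (Complex.I / 4) * 2 : ℂ) = -1 := by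
      linear_combination Complex.I_mul_I
    rw [h2, const, const, const, ← C_mul, ← C_mul, h3, C_neg, C_1]
  have hP : (const (2 * Complex.I) * const Complex.I * const (-(1 / 2)) : SusyPoly N) = 1 := by
    have h3 : (2 * Complex.I * Complex.I * (-(1 / 2)) : ℂ) = 1 := by
      linear_combination -Complex.I_mul_I
    rw [const, const, const, ← C_mul, ← C_mul, h3, C_1]
  have hdet := sum_sum_mul_eq_two_mul_det s (fun i => (X (i, 0) : SusyPoly N))
    (fun i => X (i, 3)) (fun i => X (i, 1)) (fun i => X (i, 2))
  have h1 : ∑ i ∈ s, ∑ j ∈ s,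
      spinorDot (standardRep t) (xiPlus (standardRep t) i) (xiPlus (standardRep t) j) *
        spinorDot (standardRep t) (xiMinus (standardRep t) i) (xiMinus (standardRep t) j) =
      -(2 * blockDet (quadricRest N)) := by
    have h2 : blockDet (quadricRest N) = (∑ i ∈ s, X (i, 0) * X (i, 1)) *
        (∑ i ∈ s, X (i, 3) * X (i, 2)) - (∑ i ∈ s, X (i, 0) * X (i, 2)) *
        ∑ i ∈ s, X (i, 3) * X (i, 1) := rfl
    rw [h2, ← hdet, ← Finset.sum_neg_distrib]
    refine Finset.sum_congr rfl fun i _ => ?_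
    rw [← Finset.sum_neg_distrib]
    refine Finset.sum_congr rfl fun j _ => ?_
    simp only [spinorDot_standardRep, xiPlus_standardRep, xiMinus_standardRep]
    simp [xi]
    linear_combination ((X (i, 3) * X (j, 0) - X (i, 0) * X (j, 3)) *
      (X (i, 2) * X (j, 1) - X (i, 1) * X (j, 2))) * hI
  have h3 : ∑ i ∈ s, (spinorDot (standardRep t) (xiMinus (standardRep t) 0)
        (xiMinus (standardRep t) i) * (∑ α : Fin 4, xiPlus (standardRep t) i α *
          (![const (-(1 / 2)) * P 0, 0, 0, const (-(1 / 2)) * P 1] : Fin 4 → SusyPoly N) α) +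
      spinorDot (standardRep t) (xiPlus (standardRep t) 0)
        (xiPlus (standardRep t) i) * (∑ α : Fin 4, xiMinus (standardRep t) i α *
          (![0, const (-(1 / 2)) * Q 0, const (-(1 / 2)) * Q 1, 0] : Fin 4 → SusyPoly N) α)) =
      const Complex.I * const (-(1 / 2)) *
        (∑ α, blockMinor (negBlock N) (fun α β => quadricRest N β α) α * P α +
        ∑ β, blockMinor (posBlock N) (quadricRest N) β * Q β) := by
    simp only [spinorDot_standardRep, xiPlus_standardRep, xiMinus_standardRep, Fin.sum_univ_four,
      Fin.sum_univ_two, blockMinor, quadricRest, Finset.mul_sum, ← Finset.sum_sub_distrib,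
      Finset.sum_mul, ← Finset.sum_add_distrib]
    refine Finset.sum_congr rfl fun i _ => ?_
    simp [xi, posBlock, negBlock, posIdx, negIdx]
    ring
  rw [explicitCoboundary, h1, h3]
  linear_combination (-(blockDet (quadricRest N) * B)) * hB +
    (∑ α, blockMinor (negBlock N) (fun α β => quadricRest N β α) α * P α +
        ∑ β, blockMinor (posBlock N) (quadricRest N) β * Q β) * hP

end ExplicitStandard

end SusyCohomology

theorem mainTheorem3 (t : ℕ) (ht : t ≤ 4) (ρ : SpinorRep)
    (hρ : SpinorRep.Equivalent (standardRep t) ρ) (N : ℕ) [NeZero N] (hN : 2 < N) :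
    -- (i) the general solution of the cocycle condition
    (∀ ω : GhostPoly N, gh t ρ ω = 0 ↔
      ∃ P ∈ polyMinus ρ N, ∃ Q ∈ polyPlus ρ N, Cohomologous t ρ ω (ofSusy (P + Q))) ∧
    -- (ii) the coboundaries among these solutions
    (∀ P ∈ polyMinus ρ N, ∀ Q ∈ polyPlus ρ N,
      (Cohomologous t ρ (ofSusy (P + Q)) 0 ↔
        ∃ B ∈ polyRest N, ∃ P' Q' : Fin 4 → SusyPoly N,
          (∀ α, P' α ∈ polyMinus ρ N) ∧ (∀ α, Q' α ∈ polyPlus ρ N) ∧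
          ofSusy (P + Q) = gh t ρ (primitiveOf ρ B P' Q'))) ∧
    -- the explicit form of these coboundaries
    (∀ B ∈ polyRest N, ∀ P' Q' : Fin 4 → SusyPoly N,
      (∀ α, P' α ∈ polyMinus ρ N) → (∀ α, Q' α ∈ polyPlus ρ N) →
      gh t ρ (primitiveOf ρ B P' Q') = ofSusy (explicitCoboundary ρ B P' Q')) ∧
    -- the cohomology vanishes at all positive degrees in the translation ghosts
    (∀ p : ℕ, 0 < p → ∀ ω ∈ cDegreePart N p, gh t ρ ω = 0 → Cohomologous t ρ ω 0) := by
  obtain ⟨S, hS, hγ, hΓ, hC⟩ := hρ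
  have h : ChangesBy S (standardRep t) ρ := ⟨hS, hγ, hΓ, hC⟩
  have hreg := weaklyRegular_ghDual (N := N) h hN
  set ψ := spinorEquiv N S h.isUnit with hψ
  refine ⟨fun ω => ⟨fun hω => ?_, ?_⟩, fun P hP Q hQ => ⟨fun hPQ => ?_, ?_⟩,
    fun B _ P' Q' _ _ => gh_primitiveOf_eq h B P' Q', fun p hp ω hω hgh => ?_⟩
  · obtain ⟨η, r, hr⟩ := exists_contr_add_algebraMap (quadricBasis t N) (ghDual t ρ N) hreg ω
      (by rw [← gh_eq_contr]; exact hω)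
    obtain ⟨P, hP, Q, hQ, c, hc⟩ := exists_unmixed_add_relators blocks_quadricRest (ψ.symm r)
    obtain ⟨ζ, hζ⟩ := (exists_gh_eq_ofSusy_iff (t := t) h (r - (ψ P + ψ Q))).2 ⟨c, by
      rw [← hψ, map_sub, map_add, AlgEquiv.symm_apply_apply, AlgEquiv.symm_apply_apply, hc,
        add_sub_cancel_left]
      simp only [relator_eq_quadric]⟩
    refine ⟨ψ P, (mem_polyMinus_iff h _).2 (by rwa [← hψ, AlgEquiv.symm_apply_apply]),
      ψ Q, (mem_polyPlus_iff h _).2 (by rwa [← hψ, AlgEquiv.symm_apply_apply]), η + ζ, ?_⟩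
    rw [map_add, hζ, ofSusy_sub, gh_eq_contr, hr, add_sub_assoc]
  · rintro ⟨P, -, Q, -, η, hη⟩
    have h1 : gh t ρ (ω - ofSusy (P + Q)) = 0 := by
      rw [hη, gh_eq_contr]
      exact CliffordAlgebra.contractLeft_contractLeft _ _
    rwa [map_sub, gh_eq_contr, contr_algebraMap, sub_zero, ← gh_eq_contr] at h1
  · obtain ⟨η, hη⟩ := hPQ
    rw [sub_zero] at hη
    obtain ⟨c, hc⟩ := (exists_gh_eq_ofSusy_iff h (P + Q)).1 ⟨η, hη.symm⟩
    simp only [← relator_eq_quadric] at hc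
    have hun : IsUnmixed (posBlock N) (negBlock N) (ψ.symm (P + Q)) :=
      ⟨ψ.symm P, (mem_polyMinus_iff h P).1 hP, ψ.symm Q, (mem_polyPlus_iff h Q).1 hQ, map_add _ _ _⟩
    obtain ⟨B, hB, P₁, Q₁, hP₁, hQ₁, heq⟩ := isMinorComb_of_isUnmixed blocks_quadricRest c
      (hc ▸ hun)
    rw [← hc, ← explicitCoboundary_standardRep (t := t)] at heq
    have hmem (A : Subalgebra ℂ (SusyPoly N)) (z : ℂ) {q : SusyPoly N} (hq : q ∈ A) :
        const z * q ∈ A := mul_mem (A.algebraMap_mem z) hq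
    set P₂ : Fin 4 → SusyPoly N := ![const (-(1 / 2)) * P₁ 0, 0, 0, const (-(1 / 2)) * P₁ 1]
    set Q₂ : Fin 4 → SusyPoly N := ![0, const (-(1 / 2)) * Q₁ 0, const (-(1 / 2)) * Q₁ 1, 0]
    have hP₂ (γ : Fin 4) : P₂ γ ∈ freeOf ℂ (posBlock N) := by
      fin_cases γ
      exacts [hmem _ _ (hP₁ 0), zero_mem _, zero_mem _, hmem _ _ (hP₁ 1)]
    have hQ₂ (γ : Fin 4) : Q₂ γ ∈ freeOf ℂ (negBlock N) := by
      fin_cases γ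
      exacts [zero_mem _, hmem _ _ (hQ₁ 0), hmem _ _ (hQ₁ 1), zero_mem _]
    refine ⟨ψ (const (Complex.I / 4) * B), spinorEquiv_mem_polyRest h.isUnit (hmem _ _ hB),
      spinorMul S⁻¹.transpose fun γ => ψ (P₂ γ), spinorMul S⁻¹.transpose fun γ => ψ (Q₂ γ),
      fun α => spinorMul_mem _ (fun γ => (mem_polyMinus_iff h _).2 ?_) α,
      fun α => spinorMul_mem _ (fun γ => (mem_polyPlus_iff h _).2 ?_) α, ?_⟩
    · rw [← hψ, AlgEquiv.symm_apply_apply]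
      exact hP₂ γ
    · rw [← hψ, AlgEquiv.symm_apply_apply]
      exact hQ₂ γ
    · rw [gh_primitiveOf_eq h]
      refine congrArg ofSusy ?_
      rw [hψ, explicitCoboundary_equiv h, ← heq, AlgEquiv.apply_symm_apply]
  · rintro ⟨B, -, P', Q', -, -, hB⟩
    exact ⟨_, by rw [sub_zero]; exact hB⟩
  · obtain ⟨η, hη⟩ := exists_contr_eq_of_mem_exteriorPower (quadricBasis t N) (ghDual t ρ N) hreg
      hp hω (by rw [← gh_eq_contr]; exact hgh)
    exact ⟨η, by rw [sub_zero, gh_eq_contr, hη]⟩
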